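/- Let $M$ be a compact boundaryless smooth manifold of finite dimension with a smooth Riemannian metric, let $\mathrm{dist}$ be the induced distance (possibly infinite between points of different components) and $m$ the normalized Riemannian volume. Let $f:M\to M$ be a $C^1$ diffeomorphism. For $n\in\mathbb N$ put $B_1=\{t\in\mathbb R^n:\|t\|_2<1\}$, and for $\varepsilon\in(0,1)$ let $\overline B_\varepsilon$ be the closed ball of radius $\varepsilon$ around $0$ in $\mathbb R^n$, $\Delta_\varepsilon=\{\underline t=(t_j)_{j\ge1}: t_j\in\overline B_\varepsilon\}$, $\nu_\varepsilon$ the normalized Lebesgue measure on $\overline B_\varepsilon$, and $\nu_\varepsilon^\infty$ the infinite product measure on $\Delta_\varepsilon$. Let $F:M\times B_1\to M$, $F(x,t)=f_t(x)$, be a $C^1$ map such that every $f_t$ is a $C^1$ diffeomorphism, and write $f^0(x,\underline t)=x$, $f^j(x,\underline t)=f_{t_j}\circ\cdots\circ f_{t_1}(x)$. Then $F$ is a physical random perturbation of $f$ if $f_0=f$ and there is $\varepsilon_*\in(0,1)$ such that for every $\varepsilon\in(0,\varepsilon_*)$ there are $K\in\mathbb N$ and $\xi>0$ such that for all $x\in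 M$ and all $k\ge K$: $\{f^k(x,\underline t):\underline t\in\Delta_\varepsilon\}\supset B(f^k(x),\xi)$, and the image of $\nu_\varepsilon^\infty$ under $\underline t\mapsto f^k(x,\underline t)$ is absolutely continuous with respect to $m$. A trapping region of a set $\Lambda\subset M$ is a neighborhood $U$ of $\Lambda$ with $f(\overline U)\subset U$ and $\Lambda=\bigcap_{k\ge1}f^k(\overline U)$. An attractor of $f$ is a compact set $\Lambda$ with $f(\Lambda)=\Lambda$ that has a trapping region and contains a point $x$ with $\overline{\{f^k(x):k\ge1\}}=\Lambda$. A probability measure $\mu$ on $M$ governs the random orbits of $x$ at level $\varepsilon$ if for $\nu_\varepsilon^\infty$-almost every $\underline t$ and every continuous $\varphi:M\to\mathbb R$ $$\lim_{N\to\infty}\frac1N\sum_{j=0}^{N-1}\varphi(f^j(x,\underline t))=\int\varphi\,d\mu ,$$ and $\mu$ is physical at level $\varepsilon$ if it governs the random orbits of all $x$ in a set of positive $m$-measure. Theorem. Let $\Lambda$ be an attractor of $f$ and $F$ a physical random perturbation of $f$. Then there are an open trapping region $U$ of $\Lambda$ and $\varepsilon_0\in(0,1)$ such that: (a) for all $\varepsilon\in(0,\varepsilon_0)$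 and all $t\in\overline B_\varepsilon$, $f_t(\overline U)\subset U$; (b) for every $\varepsilon\in(0,\varepsilon_0)$ there is a unique probability measure $\mu^\varepsilon$ on $M$ such that $\Lambda\subset\operatorname{supp}\mu^\varepsilon\subset U$ and $\mu^\varepsilon$ governs the random orbits at level $\varepsilon$ of every $x\in U$; moreover $\mu^\varepsilon$ is physical at level $\varepsilon$, and it is the only measure physical at level $\varepsilon$ whose support is contained in $U$; (c) $\operatorname{supp}\mu^\varepsilon\to\Lambda$ in the Hausdorff distance as $\varepsilon\to0^+$. -/

import Mathlib

open Set Filter Topology MeasureTheory Bundle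
open scoped Manifold ContDiff ENNReal

noncomputable section

/-! ### Riemannian volume -/

section RiemannianVolume

variable {d : ℕ} {M : Type*} [EMetricSpace M] [ChartedSpace (EuclideanSpace ℝ (Fin d)) M]
  [RiemannianBundle (fun x : M => TangentSpace (𝓡 d) x)]

/-- The coordinate vector field `∂ᵢ` of the chart `φ` of `M` around `p`, at the point
`φ⁻¹ y` with coordinates `y`. -/
def coordVector (p : M) (y : EuclideanSpace ℝ (Fin d)) (i : Fin d) :
    TangentSpace (𝓡 d) ((chartAt (EuclideanSpace ℝ (Fin d)) p).symm y) :=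
  mfderiv 𝓘(ℝ, EuclideanSpace ℝ (Fin d)) (𝓡 d)
    (chartAt (EuclideanSpace ℝ (Fin d)) p).symm y (EuclideanSpace.single i (1 : ℝ))

/-- The matrix `gᵢⱼ = ⟨∂ᵢ, ∂ⱼ⟩` of the Riemannian metric in the chart around `p`, at the point
with coordinates `y`. -/
def metricMatrix (p : M) (y : EuclideanSpace ℝ (Fin d)) : Matrix (Fin d) (Fin d) ℝ :=
  Matrix.of fun i j => inner ℝ (coordVector p y i) (coordVector p y j)

variable [MeasurableSpace M]

/-- The Riemannian volume of the domain of the chart `φ` around `p`, as a measure on `M`: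
the image under `φ⁻¹` of the measure `√(det gᵢⱼ) dy` on the range of `φ`. -/
def chartVolume (p : M) : Measure M :=
  Measure.map (chartAt (EuclideanSpace ℝ (Fin d)) p).symm
    ((volume.restrict (chartAt (EuclideanSpace ℝ (Fin d)) p).target).withDensity
      fun y => ENNReal.ofReal (Real.sqrt (metricMatrix p y).det))

variable (d M) in
/-- The Riemannian volume of `M`. Its restriction to the domain of each chart is the measure
`chartVolume` of this chart, and it is the smallest measure which dominates all of these. -/
def riemannianVolume : Measure M :=
  ⨆ p : M, chartVolume (d := d) p

variable (d M) in
/-- The Riemannian volume, normalized to be a probability measure. -/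
def normalizedVolume : Measure M :=
  (riemannianVolume d M univ)⁻¹ • riemannianVolume d M

end RiemannianVolume

/-! ### Random perturbations -/

section Perturbations

variable {n : ℕ} {M : Type*}

variable (n) in
/-- The perturbation space `Δ_ε`. The sequence `t₁, t₂, …` is indexed by `ℕ`, so that `t_{j+1}`
is `t j`. -/
def perturbationSpace (ε : ℝ) : Set (ℕ → EuclideanSpace ℝ (Fin n)) :=
  {t | ∀ j, ‖t j‖ ≤ ε}

variable (n) in
/-- `ν_ε`, the normalized Lebesgue measure on the closed ball of radius `ε` in `ℝⁿ`. -/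
def noiseMeasure (ε : ℝ) : Measure (EuclideanSpace ℝ (Fin n)) :=
  ProbabilityTheory.cond volume (Metric.closedBall 0 ε)

variable (n) in
/-- `ν_ε^∞`, the infinite product of the measures `ν_ε`; it is carried by `Δ_ε`. -/
def noiseProduct (ε : ℝ) : Measure (ℕ → EuclideanSpace ℝ (Fin n)) :=
  Measure.infinitePi fun _ : ℕ => noiseMeasure n ε

/-- The perturbed iterate `f^j(x, t) = f_{t_j} ∘ ⋯ ∘ f_{t_1} (x)`, where `f_s = F(·, s)`. -/
def perturbedIterate (F : M → EuclideanSpace ℝ (Fin n) → M)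
    (t : ℕ → EuclideanSpace ℝ (Fin n)) : ℕ → M → M
  | 0, x => x
  | j + 1, x => F (perturbedIterate F t j x) (t j)

/-- `F`, of which only the restriction to `M × B₁` matters, is a physical random perturbation
of `f`: a `C¹` family of diffeomorphisms `f_t = F(·, t)`, `t ∈ B₁`, of `M` with `f_0 = f` such
that, for all small noise levels `ε` and after a number of steps that depends only on `ε`, the
perturbed orbits of each point fill a ball around its unperturbed orbit, of a radius that depends
only on `ε`, and their distributions are absolutely continuous. -/
structure IsPhysicalRandomPerturbation {d : ℕ} [EMetricSpace M]
    [ChartedSpace (EuclideanSpace ℝ (Fin d)) M]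
    [RiemannianBundle (fun x : M => TangentSpace (𝓡 d) x)] [MeasurableSpace M]
    (f : M → M) (F : M → EuclideanSpace ℝ (Fin n) → M) : Prop where
  contMDiffOn : ContMDiffOn ((𝓡 d).prod 𝓘(ℝ, EuclideanSpace ℝ (Fin n))) (𝓡 d) 1
    (fun q : M × EuclideanSpace ℝ (Fin n) => F q.1 q.2) (univ ×ˢ Metric.ball 0 1)
  diffeo : ∀ t ∈ Metric.ball (0 : EuclideanSpace ℝ (Fin n)) 1,
    ∃ g : M ≃ₘ^1⟮𝓡 d, 𝓡 d⟯ M, ∀ x, g x = F x t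
  map_zero : ∀ x, F x 0 = f x
  spread : ∃ ε₀ ∈ Ioo (0 : ℝ) 1, ∀ ε ∈ Ioo 0 ε₀, ∃ K : ℕ, ∃ ξ : ℝ≥0∞, 0 < ξ ∧
    (∀ x : M, ∀ j ≥ K, Metric.eball (f^[j] x) ξ ⊆
      (fun t => perturbedIterate F t j x) '' perturbationSpace n ε) ∧
    (∀ x : M, ∀ k ≥ K,
      (noiseProduct n ε).map (fun t => perturbedIterate F t k x) ≪ normalizedVolume d M)

/-- For almost every perturbation vector `t`, the time averages of all continuous functions along
the perturbed orbit of `x` converge to their integrals with respect to `μ`. -/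
def GovernsRandomOrbit [TopologicalSpace M] [MeasurableSpace M]
    (F : M → EuclideanSpace ℝ (Fin n) → M) (ε : ℝ) (μ : Measure M) (x : M) : Prop :=
  ∀ᵐ t ∂(noiseProduct n ε), ∀ φ : C(M, ℝ),
    Tendsto (fun N : ℕ => (1 / (N : ℝ)) * ∑ j ∈ Finset.range N, φ (perturbedIterate F t j x))
      atTop (𝓝 (∫ y, φ y ∂μ))

/-- `μ` is a physical probability measure of the perturbation `F` at noise level `ε`, where `m`
is the reference volume on `M`. -/
def IsPhysicalMeasure [TopologicalSpace M] [MeasurableSpace M] (m : Measure M)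
    (F : M → EuclideanSpace ℝ (Fin n) → M) (ε : ℝ) (μ : Measure M) : Prop :=
  IsProbabilityMeasure μ ∧ 0 < m {x | GovernsRandomOrbit F ε μ x}

end Perturbations

/-! ### Attractors -/

section Attractors

variable {M : Type*} [TopologicalSpace M]

/-- `U` is a trapping region of `Λ`: a neighborhood of `Λ` which `f` maps, together with its
closure, into itself, and in which `Λ` is the maximal invariant set. -/
structure IsTrappingRegion (f : M → M) (Λ U : Set M) : Prop where
  nhds : U ∈ 𝓝ˢ Λ
  trapping : f '' closure U ⊆ U
  eq_iInter : Λ = ⋂ k ≥ 1, f^[k] '' closure U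

structure IsAttractor (f : M → M) (Λ : Set M) : Prop where
  isCompact : IsCompact Λ
  invariant : f '' Λ = Λ
  trapping : ∃ U, IsTrappingRegion f Λ U
  transitive : ∃ x ∈ Λ, closure {y | ∃ k ≥ 1, y = f^[k] x} = Λ

end Attractors

end

noncomputable section

variable {n : ℕ} {M : Type*}

/-! ### Resampling one coordinate of a product measure -/

/-! Fix a small noise level and let `C` be the closure of a trapping region, forward invariant for
every map in play. After clipping the noise by a retraction onto the closed ball, the random map is
continuous and its transfer operator `P` acts on `C(M, ℝ)`. The proof is a Doeblin argument for `P`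
on `C`, followed by a law of large numbers.

The `K`-step laws have densities in the separable space `L¹(m)`. Without any continuity of these
densities, Baire's theorem yields a nonempty open `V`, inside any prescribed open set, on which the
laws nearly agree (`exists_isOpen_transferOperator_pow_nearly_constant`). Every point of `C` reaches
`V` with positive probability: zero noise brings it near `Λ`, the spreading hypothesis puts it
exactly on a dense orbit of `Λ`, and that orbit passes near every target close to `Λ`
(`exists_transferOperator_pow_pos`). By compactness this is uniform within `R` steps, so the average
`S` of the powers `P ^ (j + K)`, `j < R`, contracts oscillations on `C`
(`exists_bounds_average_transferOperator`). Averaging over `j` removes any need for a common arrival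
time. Hence `S ^ m φ` tends to a constant uniformly on `C`, and Riesz' theorem makes this constant
`∫ φ dμ`.

Along almost every random orbit the time averages of `φ - P φ` vanish, by telescoping and a strong
law for martingale differences; hence so do those of `φ - S ^ m φ`. As `S ^ m φ` is nearly `∫ φ dμ`
on `C`, `μ` governs every orbit that enters `C` (`ae_tendsto_orbitAverage`).

Uniqueness follows because two measures governing a common orbit coincide. Reachability of points
near `Λ` gives `Λ ⊆ supp μ`, and arbitrarily small trapping regions bound the support from outside,
which gives Hausdorff convergence. -/

theorem infinitePi_prod_map_update {E : Type*} [MeasurableSpace E] (ν : Measure E)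
    [IsProbabilityMeasure ν] (N : ℕ) :
    ((Measure.infinitePi fun _ : ℕ => ν).prod ν).map
      (fun p : (ℕ → E) × E => Function.update p.1 N p.2) = Measure.infinitePi fun _ : ℕ => ν := by
  have hmeas : Measurable (fun p : (ℕ → E) × E => Function.update p.1 N p.2) := by
    refine measurable_pi_iff.2 fun i => ?_
    by_cases h : i = N
    · subst h; simpa using measurable_snd
    · simp only [Function.update_of_ne h]; fun_prop
  refine Measure.eq_infinitePi _ fun s A hA => ?_
  rw [Measure.map_apply hmeas (.pi s.countable_toSet fun _ _ => hA _)]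
  by_cases hN : N ∈ s
  · have : (fun p : (ℕ → E) × E => Function.update p.1 N p.2) ⁻¹' ((s : Set ℕ).pi A) =
        (((s.erase N : Finset ℕ) : Set ℕ).pi A) ×ˢ (A N) := by
      ext ⟨t, y⟩
      simp only [mem_preimage, Set.mem_pi, mem_prod, Finset.mem_coe, Finset.mem_erase]
      constructor
      · intro h
        refine ⟨fun i hi => ?_, by simpa using h N hN⟩
        simpa [Function.update_of_ne hi.1] using h i hi.2
      · rintro ⟨h1, h2⟩ i hi
        by_cases h : i = N
        · subst h; simpa using h2
        · simpa [Function.update_of_ne h] using h1 i ⟨h, hi⟩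
    rw [this, Measure.prod_prod, Measure.infinitePi_pi _ fun i _ => hA i,
      Finset.prod_erase_mul _ _ hN]
  · have : (fun p : (ℕ → E) × E => Function.update p.1 N p.2) ⁻¹' ((s : Set ℕ).pi A) =
        ((s : Set ℕ).pi A) ×ˢ univ := by
      ext ⟨t, y⟩
      simp only [mem_preimage, Set.mem_pi, mem_prod, Finset.mem_coe, mem_univ, and_true]
      refine forall₂_congr fun i hi => ?_
      rw [Function.update_of_ne (fun h : i = N => hN (h ▸ hi))]
    rw [this, Measure.prod_prod, Measure.infinitePi_pi _ fun i _ => hA i, measure_univ, mul_one]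

/-- This Fubini identity replaces conditioning on all coordinates but `N`: the inner integral
averages over an independent copy of that coordinate. -/
theorem integral_infinitePi_eq_integral_update {E : Type*} [MeasurableSpace E] (ν : Measure E)
    [IsProbabilityMeasure ν] (N : ℕ) {h : (ℕ → E) → ℝ} (hh : Measurable h) {B : ℝ}
    (hB : ∀ t, |h t| ≤ B) :
    ∫ t, h t ∂(Measure.infinitePi fun _ : ℕ => ν) =
      ∫ t, ∫ s, h (Function.update t N s) ∂ν ∂(Measure.infinitePi fun _ : ℕ => ν) := by
  have hmeas : Measurable (fun p : (ℕ → E) × E => Function.update p.1 N p.2) := by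
    refine measurable_pi_iff.2 fun i => ?_
    by_cases h : i = N
    · subst h; simpa using measurable_snd
    · simp only [Function.update_of_ne h]; fun_prop
  conv_lhs => rw [← infinitePi_prod_map_update ν N]
  rw [integral_map hmeas.aemeasurable hh.aestronglyMeasurable, integral_prod]
  exact Integrable.of_bound (hh.comp hmeas).aestronglyMeasurable B (ae_of_all _ fun p => hB _)

/-! ### Perturbed iterates -/

section Iterates

theorem perturbedIterate_congr {F G : M → EuclideanSpace ℝ (Fin n) → M}
    {t : ℕ → EuclideanSpace ℝ (Fin n)} (h : ∀ x j, F x (t j) = G x (t j)) (j : ℕ) (x : M) :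
    perturbedIterate F t j x = perturbedIterate G t j x := by
  induction j with
  | zero => rfl
  | succ j ih => simp only [perturbedIterate, ih, h]

theorem perturbedIterate_update (G : M → EuclideanSpace ℝ (Fin n) → M)
    (t : ℕ → EuclideanSpace ℝ (Fin n)) {j N : ℕ} (hj : j ≤ N) (s : EuclideanSpace ℝ (Fin n))
    (x : M) : perturbedIterate G (Function.update t N s) j x = perturbedIterate G t j x := by
  induction j with
  | zero => rfl
  | succ j ih =>
    simp only [perturbedIterate, ih (by omega)]
    rw [Function.update_of_ne (by omega)]

theorem perturbedIterate_mem {G : M → EuclideanSpace ℝ (Fin n) → M} {C : Set M}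
    (hC : ∀ x ∈ C, ∀ s, G x s ∈ C) (t : ℕ → EuclideanSpace ℝ (Fin n)) {i j : ℕ} (hij : i ≤ j)
    {x : M} (hx : perturbedIterate G t i x ∈ C) : perturbedIterate G t j x ∈ C := by
  induction j, hij using Nat.le_induction with
  | base => exact hx
  | succ j _ ih => exact hC _ ih _

theorem perturbedIterate_zero_noise {G : M → EuclideanSpace ℝ (Fin n) → M} {f : M → M}
    (h0 : ∀ x, G x 0 = f x) (j : ℕ) (x : M) :
    perturbedIterate G (fun _ => 0) j x = f^[j] x := by
  induction j with
  | zero => rfl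
  | succ j ih => simp only [perturbedIterate, ih, h0, Function.iterate_succ_apply']

theorem continuous_perturbedIterate [TopologicalSpace M] {G : M → EuclideanSpace ℝ (Fin n) → M}
    (hG : Continuous (Function.uncurry G)) (j : ℕ) :
    Continuous fun q : (ℕ → EuclideanSpace ℝ (Fin n)) × M => perturbedIterate G q.1 j q.2 := by
  induction j with
  | zero => exact continuous_snd
  | succ j ih =>
    have : Continuous fun q : (ℕ → EuclideanSpace ℝ (Fin n)) × M => q.1 j := by fun_prop
    exact hG.comp (ih.prodMk this)

end Iterates

/-! ### The transfer operator -/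

section Transfer

variable [EMetricSpace M] [CompactSpace M]

/-- The transfer operator `φ ↦ (x ↦ ∫ φ (G x s) dν(s))` of a random map. -/
def transferOperator (G : M → EuclideanSpace ℝ (Fin n) → M) (hG : Continuous (Function.uncurry G))
    (ν : Measure (EuclideanSpace ℝ (Fin n))) [IsProbabilityMeasure ν] : Module.End ℝ C(M, ℝ) where
  toFun φ := ⟨fun x => ∫ s, φ (G x s) ∂ν, by
    refine continuous_of_dominated (bound := fun _ => ‖φ‖) (fun x => ?_)
      (fun x => ae_of_all _ fun s => φ.norm_coe_le_norm _) (integrable_const _)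
      (ae_of_all _ fun s => ?_)
    · exact (φ.continuous.comp (hG.comp (by fun_prop : Continuous fun s => (x, s))))
        |>.aestronglyMeasurable
    · exact φ.continuous.comp (hG.comp (by fun_prop : Continuous fun x => (x, s)))⟩
  map_add' φ ψ := by
    ext x
    have h : ∀ φ : C(M, ℝ), Integrable (fun s => φ (G x s)) ν := fun φ =>
      Integrable.of_bound (φ.continuous.comp (hG.comp
        (by fun_prop : Continuous fun s => (x, s)))).aestronglyMeasurable ‖φ‖
        (ae_of_all _ fun s => φ.norm_coe_le_norm _)
    exact integral_add (h φ) (h ψ)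
  map_smul' c φ := by
    ext x
    exact integral_const_mul c _

variable {G : M → EuclideanSpace ℝ (Fin n) → M} (hG : Continuous (Function.uncurry G))
  (ν : Measure (EuclideanSpace ℝ (Fin n))) [IsProbabilityMeasure ν]

theorem transferOperator_apply (φ : C(M, ℝ)) (x : M) :
    transferOperator G hG ν φ x = ∫ s, φ (G x s) ∂ν := rfl

theorem integrable_comp_randomMap (hG : Continuous (Function.uncurry G)) (φ : C(M, ℝ)) (x : M) : Integrable (fun s => φ (G x s)) ν :=
  Integrable.of_bound (φ.continuous.comp (hG.comp
    (by fun_prop : Continuous fun s => (x, s)))).aestronglyMeasurable ‖φ‖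
    (ae_of_all _ fun s => φ.norm_coe_le_norm _)

theorem transferOperator_one : transferOperator G hG ν 1 = 1 := by
  ext x
  simp [transferOperator_apply]

theorem transferOperator_mono {C : Set M} (hC : ∀ x ∈ C, ∀ s, G x s ∈ C) {φ ψ : C(M, ℝ)}
    (h : ∀ x ∈ C, φ x ≤ ψ x) : ∀ x ∈ C, transferOperator G hG ν φ x ≤ transferOperator G hG ν ψ x :=
  fun x hx => integral_mono (integrable_comp_randomMap ν hG φ x)
    (integrable_comp_randomMap ν hG ψ x) fun s => h _ (hC x hx s)

theorem transferOperator_pow_mono {C : Set M} (hC : ∀ x ∈ C, ∀ s, G x s ∈ C) (k : ℕ)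
    {φ ψ : C(M, ℝ)} (h : ∀ x ∈ C, φ x ≤ ψ x) :
    ∀ x ∈ C, (transferOperator G hG ν ^ k) φ x ≤ (transferOperator G hG ν ^ k) ψ x := by
  induction k with
  | zero => simpa using h
  | succ k ih =>
    simp only [pow_succ', Module.End.mul_apply]
    exact transferOperator_mono hG ν hC ih

theorem transferOperator_pow_one (k : ℕ) : (transferOperator G hG ν ^ k) 1 = 1 := by
  induction k with
  | zero => rfl
  | succ k ih => rw [pow_succ', Module.End.mul_apply, ih, transferOperator_one]

theorem integral_perturbedIterate (k : ℕ) (φ : C(M, ℝ)) (x : M) :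
    ∫ t, φ (perturbedIterate G t k x) ∂(Measure.infinitePi fun _ : ℕ => ν) =
      (transferOperator G hG ν ^ k) φ x := by
  induction k generalizing φ with
  | zero => simp [perturbedIterate]
  | succ k ih =>
    have hc : Continuous fun t => φ (perturbedIterate G t (k + 1) x) :=
      φ.continuous.comp ((continuous_perturbedIterate hG (k + 1)).comp
        (by fun_prop : Continuous fun t => (t, x)))
    rw [integral_infinitePi_eq_integral_update ν k hc.measurable
      (fun t => φ.norm_coe_le_norm _), pow_succ, Module.End.mul_apply, ← ih]
    refine integral_congr_ae (ae_of_all _ fun t => ?_)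
    simp only [perturbedIterate, perturbedIterate_update G t le_rfl, Function.update_self,
      transferOperator_apply]

end Transfer

/-! ### A strong law of large numbers for bounded martingale differences -/

/-- Each increment is orthogonal to the preceding partial sum, so the cross term in the expanded
square disappears and second moments grow at most linearly. -/
theorem integral_sq_sum_le_of_uncorrelated {Ω : Type*} [MeasurableSpace Ω] (ρ : Measure Ω)
    [IsProbabilityMeasure ρ] {D : ℕ → Ω → ℝ} (hD : ∀ j, Measurable (D j)) {B : ℝ}
    (hB : ∀ j w, |D j w| ≤ B)
    (h0 : ∀ N, ∫ w, (∑ j ∈ Finset.range N, D j w) * D N w ∂ρ = 0) (N : ℕ) :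
    ∫ w, (∑ j ∈ Finset.range N, D j w) ^ 2 ∂ρ ≤ N * B ^ 2 := by
  have hS : ∀ N, Measurable fun w => ∑ j ∈ Finset.range N, D j w := fun N =>
    Finset.measurable_fun_sum _ fun j _ => hD j
  have hSB : ∀ N w, |∑ j ∈ Finset.range N, D j w| ≤ N * B := fun N w => by
    refine (Finset.abs_sum_le_sum_abs _ _).trans ((Finset.sum_le_sum fun j _ => hB j w).trans ?_)
    simp
  induction N with
  | zero => simp
  | succ N ih =>
    have i1 : Integrable (fun w => (∑ j ∈ Finset.range N, D j w) ^ 2) ρ := by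
      refine Integrable.of_bound ((hS N).pow_const 2).aestronglyMeasurable ((N * B) ^ 2)
        (ae_of_all _ fun w => ?_)
      rw [Real.norm_eq_abs, abs_pow]
      exact pow_le_pow_left₀ (abs_nonneg _) (hSB N w) 2
    have i2 : Integrable (fun w => (∑ j ∈ Finset.range N, D j w) * D N w) ρ := by
      refine Integrable.of_bound ((hS N).mul (hD N)).aestronglyMeasurable ((N * B) * B)
        (ae_of_all _ fun w => ?_)
      rw [Real.norm_eq_abs, abs_mul]
      exact mul_le_mul (hSB N w) (hB N w) (abs_nonneg _) ((abs_nonneg _).trans (hSB N w))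
    have hsq : ∀ w, D N w ^ 2 ≤ B ^ 2 := fun w => sq_le_sq' (neg_le_of_abs_le (hB N w))
      (le_of_abs_le (hB N w))
    have i3 : Integrable (fun w => D N w ^ 2) ρ := by
      refine Integrable.of_bound ((hD N).pow_const 2).aestronglyMeasurable (B ^ 2)
        (ae_of_all _ fun w => ?_)
      rw [Real.norm_eq_abs, abs_of_nonneg (sq_nonneg _)]
      exact hsq w
    have e : ∀ w, (∑ j ∈ Finset.range (N + 1), D j w) ^ 2 =
        (∑ j ∈ Finset.range N, D j w) ^ 2 + 2 * ((∑ j ∈ Finset.range N, D j w) * D N w)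
          + D N w ^ 2 := fun w => by
      rw [Finset.sum_range_succ]; ring
    simp_rw [e]
    have i12 : Integrable (fun w => (∑ j ∈ Finset.range N, D j w) ^ 2 +
        2 * ((∑ j ∈ Finset.range N, D j w) * D N w)) ρ := i1.add (i2.const_mul 2)
    rw [integral_add i12 i3, integral_add i1 (i2.const_mul 2),
      integral_const_mul, h0 N]
    have : ∫ w, D N w ^ 2 ∂ρ ≤ B ^ 2 := by
      have := integral_mono i3 (integrable_const (B ^ 2)) hsq
      simpa using this
    push_cast
    linarith

theorem ae_tendsto_average_of_uncorrelated {Ω : Type*} [MeasurableSpace Ω] (ρ : Measure Ω)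
    [IsProbabilityMeasure ρ] {D : ℕ → Ω → ℝ} (hD : ∀ j, Measurable (D j)) {B : ℝ}
    (hB : ∀ j w, |D j w| ≤ B)
    (h0 : ∀ N, ∫ w, (∑ j ∈ Finset.range N, D j w) * D N w ∂ρ = 0) :
    ∀ᵐ w ∂ρ, Tendsto (fun N : ℕ => (∑ j ∈ Finset.range N, D j w) / N) atTop (𝓝 0) := by
  set S : ℕ → Ω → ℝ := fun N w => ∑ j ∈ Finset.range N, D j w with hSdef
  have hS : ∀ N, Measurable (S N) := fun N => Finset.measurable_fun_sum _ fun j _ => hD j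
  have hSB : ∀ N w, |S N w| ≤ N * B := fun N w => by
    refine (Finset.abs_sum_le_sum_abs _ _).trans ((Finset.sum_le_sum fun j _ => hB j w).trans ?_)
    simp
  -- Along the squares the second moment of the average is at most `B ^ 2 / k ^ 2`, which is
  -- summable, so almost sure convergence there needs no maximal inequality.
  have hterm : ∀ k : ℕ, ∫⁻ w, ENNReal.ofReal ((S (k ^ 2) w / (k ^ 2 : ℕ)) ^ 2) ∂ρ ≤
      ENNReal.ofReal (B ^ 2 * (1 / (k : ℝ) ^ 2)) := fun k => by
    rw [← ofReal_integral_eq_lintegral_ofReal _ (ae_of_all _ fun w => sq_nonneg _)]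
    · refine ENNReal.ofReal_le_ofReal ?_
      simp_rw [div_pow]
      rw [integral_div]
      have h := integral_sq_sum_le_of_uncorrelated ρ hD hB h0 (k ^ 2)
      rcases Nat.eq_zero_or_pos k with rfl | hk
      · simp
      · have hk' : (0 : ℝ) < k := by exact_mod_cast hk
        rw [div_le_iff₀ (by positivity)]
        refine h.trans (le_of_eq ?_)
        push_cast
        field_simp
    · refine Integrable.of_bound (((hS _).div_const _).pow_const 2).aestronglyMeasurable
        (((k ^ 2 : ℕ) * B / (k ^ 2 : ℕ)) ^ 2) (ae_of_all _ fun w => ?_)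
      rw [Real.norm_eq_abs, abs_pow, abs_div, Nat.abs_cast]
      exact pow_le_pow_left₀ (by positivity)
        (div_le_div_of_nonneg_right (hSB _ w) (Nat.cast_nonneg _)) 2
  have hsum : ∫⁻ w, ∑' k : ℕ, ENNReal.ofReal ((S (k ^ 2) w / (k ^ 2 : ℕ)) ^ 2) ∂ρ ≠ ⊤ := by
    rw [lintegral_tsum fun k =>
      (((hS _).div_const _).pow_const 2).ennreal_ofReal.aemeasurable]
    refine ne_top_of_le_ne_top ?_ (ENNReal.tsum_le_tsum hterm)
    exact ((Real.summable_one_div_nat_pow.2 one_lt_two).mul_left (B ^ 2)).tsum_ofReal_ne_top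
  have hmeas : Measurable fun w => ∑' k : ℕ, ENNReal.ofReal ((S (k ^ 2) w / (k ^ 2 : ℕ)) ^ 2) :=
    Measurable.tsum fun k => (((hS _).div_const _).pow_const 2).ennreal_ofReal
  filter_upwards [ae_lt_top hmeas hsum] with w hw
  have hsub : Tendsto (fun k : ℕ => S (k ^ 2) w / (k ^ 2 : ℕ)) atTop (𝓝 0) := by
    have h1 := ENNReal.tendsto_atTop_zero_of_tsum_ne_top hw.ne
    have h2 := (ENNReal.tendsto_toReal ENNReal.zero_ne_top).comp h1
    simp only [Function.comp_def, ENNReal.toReal_ofReal (sq_nonneg _), ENNReal.toReal_zero] at h2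
    have h3 := h2.sqrt
    simp only [Real.sqrt_sq_eq_abs, Real.sqrt_zero] at h3
    exact (tendsto_zero_iff_abs_tendsto_zero _).2 h3
  -- Adding `N * B` makes the sums monotone, because the increments are at least `-B`. Convergence
  -- along `k ^ 2` then extends to all `N`, as the ratio of consecutive squares tends to `1`.
  have hmono : Monotone fun N : ℕ => S N w + N * B := by
    refine monotone_nat_of_le_succ fun N => ?_
    simp only [hSdef, Finset.sum_range_succ]
    push_cast
    linarith [neg_le_of_abs_le (hB N w)]
  have key := tendsto_div_of_monotone_of_exists_subseq_tendsto_div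
    (fun N : ℕ => S N w + N * B) B hmono fun a ha => by
      refine ⟨fun k => k ^ 2, ?_, tendsto_pow_atTop two_ne_zero, ?_⟩
      · have h1 : Tendsto (fun k : ℕ => (1 + 1 / (k : ℝ)) ^ 2) atTop (𝓝 ((1 + 0) ^ 2)) :=
          (tendsto_const_nhds.add tendsto_one_div_atTop_nhds_zero_nat).pow 2
        have h2 := h1.eventually (gt_mem_nhds (by simpa using ha : (1 + 0 : ℝ) ^ 2 < a))
        filter_upwards [h2, eventually_gt_atTop 0] with k hk hk0
        have hk' : (0 : ℝ) < k := by exact_mod_cast hk0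
        have : ((k + 1 : ℕ) : ℝ) ^ 2 = (1 + 1 / (k : ℝ)) ^ 2 * (k : ℝ) ^ 2 := by
          push_cast; field_simp
        push_cast at this ⊢
        rw [this]
        exact mul_le_mul_of_nonneg_right hk.le (by positivity)
      · have h1 := hsub.add_const B
        rw [zero_add] at h1
        refine h1.congr' ?_
        filter_upwards [eventually_gt_atTop 0] with k hk0
        have hk' : (k : ℝ) ≠ 0 := by exact_mod_cast hk0.ne'
        push_cast
        field_simp
  have key2 := key.sub_const B
  rw [sub_self] at key2
  refine key2.congr' ?_
  filter_upwards [eventually_gt_atTop 0] with k hk0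
  have hk' : (k : ℝ) ≠ 0 := by exact_mod_cast hk0.ne'
  field_simp
  ring

/-! ### Time averages of random orbits -/

section Averages

variable [EMetricSpace M]

/-- The average of `φ` over the first `N` points of the random orbit of `x`. -/
def orbitAverage (G : M → EuclideanSpace ℝ (Fin n) → M) (t : ℕ → EuclideanSpace ℝ (Fin n)) (x : M)
    (N : ℕ) (φ : C(M, ℝ)) : ℝ :=
  (1 / (N : ℝ)) * ∑ j ∈ Finset.range N, φ (perturbedIterate G t j x)

theorem orbitAverage_add (G : M → EuclideanSpace ℝ (Fin n) → M)
    (t : ℕ → EuclideanSpace ℝ (Fin n)) (x : M) (N : ℕ) (φ ψ : C(M, ℝ)) :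
    orbitAverage G t x N (φ + ψ) = orbitAverage G t x N φ + orbitAverage G t x N ψ := by
  simp [orbitAverage, Finset.sum_add_distrib, mul_add]

theorem orbitAverage_smul (G : M → EuclideanSpace ℝ (Fin n) → M)
    (t : ℕ → EuclideanSpace ℝ (Fin n)) (x : M) (N : ℕ) (c : ℝ) (φ : C(M, ℝ)) :
    orbitAverage G t x N (c • φ) = c * orbitAverage G t x N φ := by
  simp only [orbitAverage, ContinuousMap.smul_apply, smul_eq_mul, ← Finset.mul_sum]
  ring

theorem abs_orbitAverage_le [CompactSpace M] (G : M → EuclideanSpace ℝ (Fin n) → M)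
    (t : ℕ → EuclideanSpace ℝ (Fin n)) (x : M) (N : ℕ) (φ : C(M, ℝ)) :
    |orbitAverage G t x N φ| ≤ ‖φ‖ := by
  rw [orbitAverage, abs_mul, abs_of_nonneg (by positivity)]
  have : |∑ j ∈ Finset.range N, φ (perturbedIterate G t j x)| ≤ N * ‖φ‖ := by
    refine (Finset.abs_sum_le_sum_abs _ _).trans
      ((Finset.sum_le_sum fun j _ => φ.norm_coe_le_norm _).trans ?_)
    simp
  rcases Nat.eq_zero_or_pos N with rfl | hN
  · simp
  · have hN' : (0 : ℝ) < N := by exact_mod_cast hN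
    rw [one_div, inv_mul_le_iff₀ hN']
    exact this

variable [CompactSpace M] {G : M → EuclideanSpace ℝ (Fin n) → M}
  (hG : Continuous (Function.uncurry G))
  (ν : Measure (EuclideanSpace ℝ (Fin n))) [IsProbabilityMeasure ν]

theorem ae_tendsto_orbitAverage_sub_transferOperator (φ : C(M, ℝ)) (x : M) :
    ∀ᵐ t ∂(Measure.infinitePi fun _ : ℕ => ν), Tendsto
      (fun N => orbitAverage G t x N (φ - transferOperator G hG ν φ)) atTop (𝓝 0) := by
  set P := transferOperator G hG ν with hP
  have hc : ∀ (ψ : C(M, ℝ)) (j : ℕ), Continuous fun t => ψ (perturbedIterate G t j x) :=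
    fun ψ j => ψ.continuous.comp ((continuous_perturbedIterate hG j).comp
      (by fun_prop : Continuous fun t => (t, x)))
  set D : ℕ → (ℕ → EuclideanSpace ℝ (Fin n)) → ℝ := fun j t =>
    φ (perturbedIterate G t (j + 1) x) - P φ (perturbedIterate G t j x) with hDdef
  have hDc : ∀ j, Continuous (D j) := fun j => (hc φ (j + 1)).sub (hc (P φ) j)
  have hDB : ∀ j t, |D j t| ≤ ‖φ‖ + ‖P φ‖ := fun j t =>
    (abs_sub _ _).trans (add_le_add (φ.norm_coe_le_norm _) ((P φ).norm_coe_le_norm _))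
  have hB0 : 0 ≤ ‖φ‖ + ‖P φ‖ := by positivity
  -- The earlier differences and the position at time `N` do not involve `t N`; averaging over `t N`
  -- alone turns `φ` at the next position into `P φ` at the current one, so `D N` has mean zero.
  have h0 : ∀ N, ∫ t, (∑ j ∈ Finset.range N, D j t) * D N t
      ∂(Measure.infinitePi fun _ : ℕ => ν) = 0 := fun N => by
    have hSB : ∀ t, |∑ j ∈ Finset.range N, D j t| ≤ N * (‖φ‖ + ‖P φ‖) := fun t => by
      refine (Finset.abs_sum_le_sum_abs _ _).trans
        ((Finset.sum_le_sum fun j _ => hDB j t).trans (le_of_eq ?_))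
      rw [Finset.sum_const, Finset.card_range, nsmul_eq_mul]
    rw [integral_infinitePi_eq_integral_update ν N (B := N * (‖φ‖ + ‖P φ‖) * (‖φ‖ + ‖P φ‖))]
    · rw [← integral_zero (ℕ → EuclideanSpace ℝ (Fin n)) ℝ
        (μ := Measure.infinitePi fun _ : ℕ => ν)]
      refine integral_congr_ae (ae_of_all _ fun t => ?_)
      have e1 : ∀ s, ∑ j ∈ Finset.range N, D j (Function.update t N s) =
          ∑ j ∈ Finset.range N, D j t := fun s => by
        refine Finset.sum_congr rfl fun j hj => ?_
        have := Finset.mem_range.1 hj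
        simp only [hDdef]
        rw [perturbedIterate_update G t (by omega), perturbedIterate_update G t (by omega)]
      have e2 : ∀ s, D N (Function.update t N s) =
          φ (G (perturbedIterate G t N x) s) - P φ (perturbedIterate G t N x) := fun s => by
        simp only [hDdef, perturbedIterate, perturbedIterate_update G t le_rfl,
          Function.update_self]
      simp only [e1, e2]
      rw [integral_const_mul, integral_sub (integrable_comp_randomMap ν hG φ _)
        (integrable_const _), hP, transferOperator_apply]
      simp
    · exact ((continuous_finsetSum _ fun j _ => hDc j).mul (hDc N)).measurable
    · intro t
      rw [abs_mul]
      exact mul_le_mul (hSB t) (hDB N t) (abs_nonneg _) (by positivity)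
  filter_upwards [ae_tendsto_average_of_uncorrelated _ (fun j => (hDc j).measurable) hDB h0]
    with t ht
  -- `D j` pairs `φ` at time `j + 1` with `P φ` at time `j`; this boundary term undoes the shift.
  have hbd : Tendsto (fun N : ℕ => (φ x - φ (perturbedIterate G t N x)) / N) atTop (𝓝 0) := by
    refine squeeze_zero_norm (a := fun N : ℕ => (2 * ‖φ‖) / (N : ℝ)) (fun N => ?_)
      (tendsto_const_div_atTop_nhds_zero_nat _)
    rw [norm_div, Real.norm_natCast]
    refine div_le_div_of_nonneg_right ?_ (Nat.cast_nonneg _)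
    refine (norm_sub_le _ _).trans ?_
    linarith [φ.norm_coe_le_norm x, φ.norm_coe_le_norm (perturbedIterate G t N x)]
  have := ht.add hbd
  rw [add_zero] at this
  refine this.congr fun N => ?_
  rw [orbitAverage, ← add_div, one_div, inv_mul_eq_div]
  congr 1
  have tel : ∑ j ∈ Finset.range N, (φ (perturbedIterate G t (j + 1) x)
      - φ (perturbedIterate G t j x)) = φ (perturbedIterate G t N x) - φ x :=
    Finset.sum_range_sub (fun j => φ (perturbedIterate G t j x)) N
  simp only [hDdef, ContinuousMap.sub_apply, Finset.sum_sub_distrib] at tel ⊢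
  linarith

/-- The functions whose time averages along almost every random orbit of `x` tend to `0`. -/
def averageNullSubmodule (G : M → EuclideanSpace ℝ (Fin n) → M)
    (ν : Measure (EuclideanSpace ℝ (Fin n))) [IsProbabilityMeasure ν] (x : M) :
    Submodule ℝ C(M, ℝ) where
  carrier := {φ | ∀ᵐ t ∂(Measure.infinitePi fun _ : ℕ => ν),
    Tendsto (fun N => orbitAverage G t x N φ) atTop (𝓝 0)}
  add_mem' {φ ψ} hφ hψ := by
    rw [mem_ofPred_eq] at hφ hψ ⊢
    filter_upwards [hφ, hψ] with t h1 h2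
    simpa [orbitAverage_add] using h1.add h2
  zero_mem' := ae_of_all _ fun t => by simp [orbitAverage]
  smul_mem' c φ hφ := by
    rw [mem_ofPred_eq] at hφ ⊢
    filter_upwards [hφ] with t h1
    simpa [orbitAverage_smul] using h1.const_mul c

theorem sub_transferOperator_pow_mem (φ : C(M, ℝ)) (x : M) (k : ℕ) :
    φ - (transferOperator G hG ν ^ k) φ ∈ averageNullSubmodule G ν x := by
  induction k with
  | zero => simp
  | succ k ih =>
    rw [pow_succ', Module.End.mul_apply,
      ← sub_add_sub_cancel φ ((transferOperator G hG ν ^ k) φ)]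
    exact add_mem ih (ae_tendsto_orbitAverage_sub_transferOperator hG ν _ x)

end Averages

/-! ### Positivity of the transfer operator -/

section Positivity

variable [EMetricSpace M] [CompactSpace M] {G : M → EuclideanSpace ℝ (Fin n) → M}
  (hG : Continuous (Function.uncurry G))
  (ν : Measure (EuclideanSpace ℝ (Fin n))) [IsProbabilityMeasure ν]

theorem transferOperator_pow_nonneg {C : Set M} (hC : ∀ x ∈ C, ∀ s, G x s ∈ C) (k : ℕ)
    {φ : C(M, ℝ)} (h : ∀ x ∈ C, 0 ≤ φ x) : ∀ x ∈ C, 0 ≤ (transferOperator G hG ν ^ k) φ x := by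
  have := transferOperator_pow_mono hG ν hC k (φ := 0) (ψ := φ) h
  simpa using this

/-- Only membership of `s` in the support of `ν` matters: by continuity the integrand is positive on
a neighborhood of `s`, which has positive measure. -/
theorem transferOperator_pos {φ : C(M, ℝ)} (h0 : ∀ x, 0 ≤ φ x) {x : M}
    {s : EuclideanSpace ℝ (Fin n)} (hs : s ∈ ν.support) (h : 0 < φ (G x s)) :
    0 < transferOperator G hG ν φ x := by
  rw [transferOperator_apply, integral_pos_iff_support_of_nonneg (fun s => h0 _)
    (integrable_comp_randomMap ν hG φ x)]
  have hc : Continuous fun s => φ (G x s) :=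
    φ.continuous.comp (hG.comp (by fun_prop : Continuous fun s => (x, s)))
  exact (Measure.mem_support_iff_forall s).1 hs _
    (hc.isOpen_support.mem_nhds (by simpa using h.ne'))

theorem transferOperator_pow_pos {φ : C(M, ℝ)} (h0 : ∀ x, 0 ≤ φ x) {x : M}
    {t : ℕ → EuclideanSpace ℝ (Fin n)} (ht : ∀ j, t j ∈ ν.support) (k : ℕ)
    (h : 0 < φ (perturbedIterate G t k x)) : 0 < (transferOperator G hG ν ^ k) φ x := by
  induction k generalizing φ with
  | zero => simpa [perturbedIterate] using h
  | succ k ih =>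
    rw [pow_succ, Module.End.mul_apply]
    refine ih (fun y => ?_) (transferOperator_pos hG ν h0 (ht k) h)
    simpa using transferOperator_pow_nonneg hG ν (C := univ) (by simp) 1 (fun y _ => h0 y) y
      (mem_univ y)

theorem transferOperator_pow_add_pos {φ : C(M, ℝ)} (h0 : ∀ x, 0 ≤ φ x) {x : M}
    {t : ℕ → EuclideanSpace ℝ (Fin n)} (ht : ∀ j, t j ∈ ν.support) (k l : ℕ)
    (h : 0 < (transferOperator G hG ν ^ l) φ (perturbedIterate G t k x)) :
    0 < (transferOperator G hG ν ^ (k + l)) φ x := by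
  rw [pow_add, Module.End.mul_apply]
  exact transferOperator_pow_pos hG ν (fun y => transferOperator_pow_nonneg hG ν (C := univ)
    (by simp) l (fun y _ => h0 y) y (mem_univ y)) ht k h

/-- The partial sums are continuous and increase with `R`, so their positivity sets form an
increasing open cover of `C`; one of them suffices, and its sum attains a positive minimum. -/
theorem exists_le_sum_transferOperator_pow {C : Set M} (hC : IsCompact C) {φ : C(M, ℝ)}
    (h0 : ∀ x, 0 ≤ φ x) (h : ∀ x ∈ C, ∃ k, 0 < (transferOperator G hG ν ^ k) φ x) :
    ∃ R : ℕ, 0 < R ∧ ∃ δ : ℝ, 0 < δ ∧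
      ∀ x ∈ C, δ ≤ ∑ j ∈ Finset.range R, (transferOperator G hG ν ^ j) φ x := by
  set P := transferOperator G hG ν
  have hnn : ∀ j x, 0 ≤ (P ^ j) φ x := fun j x =>
    transferOperator_pow_nonneg hG ν (C := univ) (by simp) j (fun y _ => h0 y) x (mem_univ x)
  have hc : ∀ R, Continuous fun x => ∑ j ∈ Finset.range R, (P ^ j) φ x := fun R =>
    continuous_finsetSum _ fun j _ => ((P ^ j) φ).continuous
  have hmono : Monotone fun R : ℕ => {x | 0 < ∑ j ∈ Finset.range R, (P ^ j) φ x} := by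
    intro R R' hR x hx
    exact lt_of_lt_of_le hx (Finset.sum_le_sum_of_subset_of_nonneg
      (Finset.range_mono hR) fun j _ _ => hnn j x)
  obtain ⟨R, hR⟩ := hC.elim_directed_cover
    (fun R : ℕ => {x | 0 < ∑ j ∈ Finset.range (R + 1), (P ^ j) φ x})
    (fun R => isOpen_lt continuous_const (hc _))
    (fun x hx => by
      obtain ⟨k, hk⟩ := h x hx
      refine mem_iUnion.2 ⟨k, lt_of_lt_of_le hk ?_⟩
      exact Finset.single_le_sum (f := fun j => (P ^ j) φ x) (fun j _ => hnn j x)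
        (Finset.mem_range.2 (Nat.lt_succ_self k)))
    (directed_of_isDirected_le fun R R' hR => hmono (Nat.succ_le_succ hR))
  refine ⟨R + 1, Nat.succ_pos R, ?_⟩
  rcases C.eq_empty_or_nonempty with rfl | hne
  · exact ⟨1, one_pos, by simp⟩
  · obtain ⟨x, hx, hmin⟩ := hC.exists_isMinOn hne (hc (R + 1)).continuousOn
    exact ⟨_, hR hx, fun y hy => hmin hy⟩

/-! ### Contraction of the oscillation -/

/-- If `P ^ K` nearly equalizes values on `{χ ≠ 0}`, and all points of `C` are taken to
`{χ ≠ 0}` within `R` steps with probability bounded below, then an average of powers of `P`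
contracts the oscillation on `C`. -/
theorem exists_bounds_average_transferOperator {C : Set M} (hC : ∀ x ∈ C, ∀ s, G x s ∈ C)
    {K R : ℕ} (hR : 0 < R) {δ : ℝ} {χ : C(M, ℝ)} (hχ1 : ∀ x, χ x ≤ 1)
    (hne : C.Nonempty) (hδ0 : 0 < δ)
    (hδ : ∀ x ∈ C, δ ≤ ∑ j ∈ Finset.range R, (transferOperator G hG ν ^ j) χ x)
    (hosc : ∀ ψ : C(M, ℝ), ∀ x y, χ x ≠ 0 → χ y ≠ 0 →
      |(transferOperator G hG ν ^ K) ψ x - (transferOperator G hG ν ^ K) ψ y| ≤ 1 / 2 * ‖ψ‖)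
    {ψ : C(M, ℝ)} {a b : ℝ} (hψ : ∀ x ∈ C, a ≤ ψ x ∧ ψ x ≤ b) :
    ∃ a' b', a ≤ a' ∧ b' ≤ b ∧ b' - a' ≤ (1 - δ / (4 * R)) * (b - a) ∧ ∀ x ∈ C,
      a' ≤ ((R : ℝ)⁻¹ • ∑ j ∈ Finset.range R, transferOperator G hG ν ^ (j + K)) ψ x ∧
      ((R : ℝ)⁻¹ • ∑ j ∈ Finset.range R, transferOperator G hG ν ^ (j + K)) ψ x ≤ b' := by
  set P := transferOperator G hG ν with hP
  have hR' : (0 : ℝ) < R := by exact_mod_cast hR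
  have hone : ∀ j (c : ℝ), (P ^ j) (c • (1 : C(M, ℝ))) = c • 1 := fun j c => by
    rw [map_smul, hP, transferOperator_pow_one]
  have hab : a ≤ b := by
    obtain ⟨x, hx⟩ := hne
    exact (hψ x hx).1.trans (hψ x hx).2
  set θ := (P ^ K) ψ with hθ
  have hθa : ∀ x ∈ C, a ≤ θ x := by
    have := transferOperator_pow_mono hG ν hC K (φ := a • 1) (ψ := ψ)
      (fun x hx => by simpa using (hψ x hx).1)
    rw [← hP, hone] at this
    simpa using this
  have hθb : ∀ x ∈ C, θ x ≤ b := by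
    have := transferOperator_pow_mono hG ν hC K (φ := ψ) (ψ := b • 1)
      (fun x hx => by simpa using (hψ x hx).2)
    rw [← hP, hone] at this
    simpa using this
  have hS : ∀ x, ((R : ℝ)⁻¹ • ∑ j ∈ Finset.range R, P ^ (j + K)) ψ x =
      (R : ℝ)⁻¹ * ∑ j ∈ Finset.range R, (P ^ j) θ x := fun x => by
    simp [LinearMap.sum_apply, hθ, pow_add]
  have upper : ∀ e : ℝ, 0 ≤ e → (∀ x ∈ C, θ x ≤ b - e * χ x) → ∀ x ∈ C,
      ((R : ℝ)⁻¹ • ∑ j ∈ Finset.range R, P ^ (j + K)) ψ x ≤ b - e * (δ / R) := by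
    intro e he h x hx
    have h1 : ∀ j, (P ^ j) θ x ≤ b - e * (P ^ j) χ x := fun j => by
      have := transferOperator_pow_mono hG ν hC j (φ := θ) (ψ := b • 1 - e • χ)
        (fun x hx => by simpa using h x hx) x hx
      rw [← hP, map_sub, hone, map_smul] at this
      simpa using this
    rw [hS, inv_mul_le_iff₀ hR']
    refine (Finset.sum_le_sum fun j _ => h1 j).trans ?_
    rw [Finset.sum_sub_distrib, ← Finset.mul_sum]
    have := mul_le_mul_of_nonneg_left (hδ x hx) he
    have e1 : (R : ℝ) * (b - e * (δ / R)) = R * b - e * δ := by field_simp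
    rw [e1]
    simp only [Finset.sum_const, Finset.card_range, nsmul_eq_mul]
    linarith
  have lower : ∀ e : ℝ, 0 ≤ e → (∀ x ∈ C, a + e * χ x ≤ θ x) → ∀ x ∈ C,
      a + e * (δ / R) ≤ ((R : ℝ)⁻¹ • ∑ j ∈ Finset.range R, P ^ (j + K)) ψ x := by
    intro e he h x hx
    have h1 : ∀ j, a + e * (P ^ j) χ x ≤ (P ^ j) θ x := fun j => by
      have := transferOperator_pow_mono hG ν hC j (φ := a • 1 + e • χ) (ψ := θ)
        (fun x hx => by simpa using h x hx) x hx
      rw [← hP, map_add, hone, map_smul] at this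
      simpa using this
    rw [hS, le_inv_mul_iff₀ hR']
    refine le_trans ?_ (Finset.sum_le_sum fun j _ => h1 j)
    rw [Finset.sum_add_distrib, ← Finset.mul_sum]
    have := mul_le_mul_of_nonneg_left (hδ x hx) he
    have e1 : (R : ℝ) * (a + e * (δ / R)) = R * a + e * δ := by field_simp
    rw [e1]
    simp only [Finset.sum_const, Finset.card_range, nsmul_eq_mul]
    linarith
  -- oscillation of `θ` on `C ∩ {χ ≠ 0}`
  have hθosc : ∀ x ∈ C, ∀ y ∈ C, χ x ≠ 0 → χ y ≠ 0 → |θ x - θ y| ≤ (b - a) / 4 := by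
    intro x hx y hy hχx hχy
    -- The bounds on `ψ` hold only on `C`, whereas `hosc` involves the norm over all of `M`.
    -- Truncation leaves `P ^ K ψ` unchanged on `C`, and centering gives norm at most `(b - a) / 2`,
    -- whence oscillation at most `(b - a) / 4`.
    set ψ' : C(M, ℝ) := (ψ ⊓ (b • (1 : C(M, ℝ)))) ⊔ (a • (1 : C(M, ℝ))) with hψ'
    have hψ'x : ∀ z ∈ C, ψ' z = ψ z := fun z hz => by
      simp [hψ', (hψ z hz).1, (hψ z hz).2]
    have hθ' : ∀ z ∈ C, (P ^ K) ψ' z = θ z := fun z hz => le_antisymm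
      (transferOperator_pow_mono hG ν hC K (fun w hw => (hψ'x w hw).le) z hz)
      (transferOperator_pow_mono hG ν hC K (fun w hw => (hψ'x w hw).ge) z hz)
    have hnorm : ‖ψ' - ((a + b) / 2) • (1 : C(M, ℝ))‖ ≤ (b - a) / 2 := by
      rw [ContinuousMap.norm_le _ (by linarith)]
      intro z
      have h1 : a ≤ ψ' z := by simp [hψ']
      have h2 : ψ' z ≤ b := by simp [hψ', hab]
      rw [Real.norm_eq_abs, abs_le]
      simp only [ContinuousMap.sub_apply, ContinuousMap.smul_apply, ContinuousMap.one_apply,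
        smul_eq_mul, mul_one]
      constructor <;> linarith
    have := hosc (ψ' - ((a + b) / 2) • (1 : C(M, ℝ))) x y hχx hχy
    rw [map_sub, hone, ContinuousMap.sub_apply, ContinuousMap.sub_apply, hθ' x hx, hθ' y hy] at this
    simp only [ContinuousMap.smul_apply, ContinuousMap.one_apply, sub_sub_sub_cancel_right] at this
    linarith
  have hba : 0 ≤ (b - a) / 4 := by linarith
  have hfin : (1 - δ / (4 * R)) * (b - a) = b - a - (b - a) / 4 * (δ / R) := by
    field_simp
  have hpos : 0 ≤ (b - a) / 4 * (δ / R) := by positivity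
  -- Either `θ` stays a quarter of the gap below `b` on `{χ ≠ 0}` in `C`, or it exceeds that level
  -- somewhere there and, by `hθosc`, is at least the midpoint of `[a, b]` throughout. So one
  -- endpoint improves by `(b - a) / 4` where `χ ≠ 0`, and by `(b - a) / 4 * (δ / R)` after
  -- averaging.
  by_cases hcase : ∀ x ∈ C, χ x ≠ 0 → θ x ≤ b - (b - a) / 4
  · refine ⟨a, b - (b - a) / 4 * (δ / R), le_rfl, by linarith, by rw [hfin]; linarith,
      fun x hx => ⟨?_, upper _ hba (fun x hx => ?_) x hx⟩⟩
    · simpa using lower 0 le_rfl (by simpa using hθa) x hx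
    · by_cases hχx : χ x = 0
      · simpa [hχx] using hθb x hx
      · have := mul_le_mul_of_nonneg_left (hχ1 x) hba
        linarith [hcase x hx hχx]
  · push Not at hcase
    obtain ⟨v, hv, hχv, hθv⟩ := hcase
    refine ⟨a + (b - a) / 4 * (δ / R), b, by linarith, le_rfl, by rw [hfin]; linarith,
      fun x hx => ⟨lower _ hba (fun x hx => ?_) x hx, ?_⟩⟩
    · by_cases hχx : χ x = 0
      · simpa [hχx] using hθa x hx
      · have := mul_le_mul_of_nonneg_left (hχ1 x) hba
        have h2 := abs_le.1 (hθosc x hx v hv hχx hχv)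
        linarith [h2.1]
    · simpa using upper 0 le_rfl (by simpa using hθb) x hx

end Positivity

/-! ### The limit measure of a contraction of oscillations -/

section LimitMeasure

variable [EMetricSpace M] [CompactSpace M] [MeasurableSpace M] [BorelSpace M]

/-- The ranges of `S ^ m φ` on `C` lie in nested intervals of geometrically shrinking length. Their
common limit is a positive normalized functional of `φ`, to which the Riesz representation theorem
applies. -/
theorem exists_measure_of_oscillation_contraction {C : Set M} (hne : C.Nonempty)
    {S : Module.End ℝ C(M, ℝ)} {r : ℝ} (hr0 : 0 ≤ r) (hr1 : r < 1)
    (hS : ∀ (ψ : C(M, ℝ)) (a b : ℝ), (∀ x ∈ C, a ≤ ψ x ∧ ψ x ≤ b) →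
      ∃ a' b', a ≤ a' ∧ b' ≤ b ∧ b' - a' ≤ r * (b - a) ∧ ∀ x ∈ C, a' ≤ S ψ x ∧ S ψ x ≤ b') :
    ∃ μ : Measure M, IsProbabilityMeasure μ ∧ ∀ (φ : C(M, ℝ)), ∀ η > 0, ∃ m : ℕ, ∀ x ∈ C,
      |(S ^ m) φ x - ∫ y, φ y ∂μ| ≤ η := by
  have hinv : ∀ (ψ : C(M, ℝ)) (a b : ℝ), (∀ x ∈ C, a ≤ ψ x ∧ ψ x ≤ b) →
      ∀ k, ∀ x ∈ C, a ≤ (S ^ k) ψ x ∧ (S ^ k) ψ x ≤ b := by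
    intro ψ a b h k
    induction k with
    | zero => simpa using h
    | succ k ih =>
      obtain ⟨a', b', ha, hb, -, h'⟩ := hS _ a b ih
      intro x hx
      rw [pow_succ', Module.End.mul_apply]
      exact ⟨ha.trans (h' x hx).1, (h' x hx).2.trans hb⟩
  have hcontr : ∀ (ψ : C(M, ℝ)) (m : ℕ), ∃ a b, b - a ≤ r ^ m * (2 * ‖ψ‖) ∧
      ∀ x ∈ C, a ≤ (S ^ m) ψ x ∧ (S ^ m) ψ x ≤ b := by
    intro ψ m
    induction m with
    | zero =>
      refine ⟨-‖ψ‖, ‖ψ‖, by linarith, fun x _ => ?_⟩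
      exact ⟨ψ.neg_norm_le_apply x, ψ.apply_le_norm x⟩
    | succ m ih =>
      obtain ⟨a, b, hab, h⟩ := ih
      obtain ⟨a', b', -, -, hab', h'⟩ := hS _ a b h
      refine ⟨a', b', hab'.trans ?_, fun x hx => ?_⟩
      · rw [pow_succ', mul_assoc]
        exact mul_le_mul_of_nonneg_left hab hr0
      · rw [pow_succ', Module.End.mul_apply]
        exact h' x hx
  obtain ⟨x₀, hx₀⟩ := hne
  have hdist : ∀ (ψ : C(M, ℝ)) (m k : ℕ), ∀ x ∈ C, ∀ y ∈ C, m ≤ k →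
      |(S ^ m) ψ x - (S ^ k) ψ y| ≤ r ^ m * (2 * ‖ψ‖) := by
    intro ψ m k x hx y hy hmk
    obtain ⟨a, b, hab, h⟩ := hcontr ψ m
    have h2 := hinv _ a b h (k - m) y hy
    rw [← Module.End.mul_apply, ← pow_add, Nat.sub_add_cancel hmk] at h2
    have h1 := h x hx
    rw [abs_le]
    constructor <;> linarith
  have hr : ∀ c : ℝ, Tendsto (fun m : ℕ => r ^ m * c) atTop (𝓝 0) := fun c => by
    simpa using (tendsto_pow_atTop_nhds_zero_of_lt_one hr0 hr1).mul_const c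
  have hlim : ∀ ψ : C(M, ℝ), ∃ c, Tendsto (fun m => (S ^ m) ψ x₀) atTop (𝓝 c) := fun ψ =>
    cauchySeq_tendsto_of_complete (cauchySeq_of_le_tendsto_0' (fun m => r ^ m * (2 * ‖ψ‖))
      (fun m k hmk => by
        rw [Real.dist_eq]
        exact hdist ψ m k x₀ hx₀ x₀ hx₀ hmk) (hr _))
  choose L hL using hlim
  let Λ : CompactlySupportedContinuousMap M ℝ →ₚ[ℝ] ℝ :=
    { toFun g := L g.toContinuousMap
      map_add' g g' := tendsto_nhds_unique (hL _) (by
        have e : (g + g').toContinuousMap = g.toContinuousMap + g'.toContinuousMap := rfl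
        simpa [e] using (hL g.toContinuousMap).add (hL g'.toContinuousMap))
      map_smul' c g := tendsto_nhds_unique (hL _) (by
        have e : (c • g).toContinuousMap = c • g.toContinuousMap := rfl
        simpa [e] using (hL g.toContinuousMap).const_mul c)
      monotone' g g' hgg' := by
        refine le_of_tendsto_of_tendsto' (hL _) (hL _) fun m => ?_
        have h := (hinv (g'.toContinuousMap - g.toContinuousMap) 0
          ‖g'.toContinuousMap - g.toContinuousMap‖
          (fun x _ => ⟨sub_nonneg.2 (hgg' x), ContinuousMap.apply_le_norm _ x⟩) m x₀ hx₀).1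
        rw [map_sub] at h
        exact sub_nonneg.1 h }
  set μ := RealRMK.rieszMeasure Λ with hμ
  have hint : ∀ φ : C(M, ℝ), ∫ y, φ y ∂μ = L φ := fun φ =>
    RealRMK.integral_rieszMeasure Λ ⟨φ, HasCompactSupport.of_compactSpace _⟩
  refine ⟨μ, ⟨?_⟩, fun φ η hη => ?_⟩
  · have h1 : L 1 = 1 := by
      refine tendsto_nhds_unique (hL 1) (tendsto_const_nhds.congr fun m => ?_)
      have := hinv 1 1 1 (by simp) m x₀ hx₀
      exact le_antisymm this.1 this.2
    have h2 := hint 1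
    rw [h1] at h2
    simp only [ContinuousMap.one_apply, integral_const, smul_eq_mul, mul_one] at h2
    rw [measureReal_def] at h2
    rw [← ENNReal.ofReal_toReal (measure_ne_top μ univ), h2, ENNReal.ofReal_one]
  · obtain ⟨m, hm⟩ := ((hr (2 * ‖φ‖)).eventually (gt_mem_nhds hη)).exists
    refine ⟨m, fun x hx => ?_⟩
    rw [hint]
    refine le_trans ?_ hm.le
    refine le_of_tendsto (tendsto_const_nhds.sub (hL φ)).abs ?_
    filter_upwards [eventually_ge_atTop m] with k hk using hdist φ m k x hx x₀ hx₀ hk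

end LimitMeasure

/-! ### Convergence of time averages -/

/-- The first `i` terms contribute at most `η` to the average once `N` is large, the remaining ones
at most `η` for every `N`. -/
theorem eventually_abs_average_sub_le {u : ℕ → ℝ} {c η : ℝ} (hη : 0 < η) {i : ℕ}
    (h : ∀ j ≥ i, |u j - c| ≤ η) :
    ∀ᶠ N : ℕ in atTop, |(1 / (N : ℝ)) * ∑ j ∈ Finset.range N, u j - c| ≤ 2 * η := by
  have hA := (tendsto_const_div_atTop_nhds_zero_nat
    (∑ j ∈ Finset.range i, |u j - c|)).eventually (gt_mem_nhds hη)
  filter_upwards [hA, eventually_ge_atTop i, eventually_gt_atTop 0] with N hN hiN hN0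
  have hN' : (0 : ℝ) < N := by exact_mod_cast hN0
  have e : (1 / (N : ℝ)) * ∑ j ∈ Finset.range N, u j - c =
      (∑ j ∈ Finset.range N, (u j - c)) / N := by
    rw [Finset.sum_sub_distrib]
    simp only [Finset.sum_const, Finset.card_range, nsmul_eq_mul]
    field_simp
  rw [e, abs_div, Nat.abs_cast, div_le_iff₀ hN']
  rw [div_lt_iff₀ hN'] at hN
  have h1 : ∑ j ∈ Finset.Ico i N, |u j - c| ≤ N * η := by
    refine (Finset.sum_le_sum fun j hj => h j (Finset.mem_Ico.1 hj).1).trans ?_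
    rw [Finset.sum_const, Nat.card_Ico, nsmul_eq_mul]
    exact mul_le_mul_of_nonneg_right (by exact_mod_cast Nat.sub_le N i) hη.le
  have h2 := Finset.abs_sum_le_sum_abs (fun j => u j - c) (Finset.range N)
  rw [← Finset.sum_range_add_sum_Ico (fun j => |u j - c|) hiN] at h2
  linarith

section Convergence

variable [EMetricSpace M] [CompactSpace M] {G : M → EuclideanSpace ℝ (Fin n) → M}
  (hG : Continuous (Function.uncurry G))
  (ν : Measure (EuclideanSpace ℝ (Fin n))) [IsProbabilityMeasure ν]

/-- `ψ - S ψ` is the average of the functions `ψ - P ^ (j + K) ψ`, and `φ - S ^ m φ` telescopes into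
such terms. -/
theorem sub_average_transferOperator_pow_mem {R : ℕ} (hR : 0 < R) (K m : ℕ) (φ : C(M, ℝ)) (x : M) :
    φ - (((R : ℝ)⁻¹ • ∑ j ∈ Finset.range R, transferOperator G hG ν ^ (j + K)) ^ m) φ ∈
      averageNullSubmodule G ν x := by
  set S := (R : ℝ)⁻¹ • ∑ j ∈ Finset.range R, transferOperator G hG ν ^ (j + K) with hS
  have h1 : ∀ ψ : C(M, ℝ), ψ - S ψ ∈ averageNullSubmodule G ν x := fun ψ => by
    have hR' : (R : ℝ) ≠ 0 := by exact_mod_cast hR.ne'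
    have e : ψ - S ψ = (R : ℝ)⁻¹ • ∑ j ∈ Finset.range R,
        (ψ - (transferOperator G hG ν ^ (j + K)) ψ) := by
      rw [Finset.sum_sub_distrib, smul_sub, Finset.sum_const, Finset.card_range, hS,
        LinearMap.smul_apply, LinearMap.sum_apply, ← Nat.cast_smul_eq_nsmul ℝ R ψ,
        inv_smul_smul₀ hR']
    rw [e]
    exact Submodule.smul_mem _ _ (Submodule.sum_mem _ fun j _ =>
      sub_transferOperator_pow_mem hG ν ψ x _)
  induction m with
  | zero => simp
  | succ m ih =>
    rw [pow_succ', Module.End.mul_apply, ← sub_add_sub_cancel φ ((S ^ m) φ)]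
    exact add_mem ih (h1 _)

variable [MeasurableSpace M] [BorelSpace M]

theorem ae_tendsto_orbitAverage {C : Set M} (hC : ∀ x ∈ C, ∀ s, G x s ∈ C) (μ : Measure M)
    [IsProbabilityMeasure μ]
    (h : ∀ φ : C(M, ℝ), ∀ η > 0, ∃ ψ : C(M, ℝ), (∀ x, φ - ψ ∈ averageNullSubmodule G ν x) ∧
      ∀ x ∈ C, |ψ x - ∫ y, φ y ∂μ| ≤ η) (x : M) :
    ∀ᵐ t ∂(Measure.infinitePi fun _ : ℕ => ν), (∃ i, perturbedIterate G t i x ∈ C) →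
      ∀ φ : C(M, ℝ), Tendsto (fun N => orbitAverage G t x N φ) atTop (𝓝 (∫ y, φ y ∂μ)) := by
  -- A countable dense family of test functions, with countably many tolerances, leaves a single
  -- exceptional null set for all `φ`.
  set u := TopologicalSpace.denseSeq C(M, ℝ) with hu
  choose ψ hψ1 hψ2 using fun (k l : ℕ) => h (u k) (1 / ((l : ℝ) + 1)) (by positivity)
  have hae : ∀ᵐ t ∂(Measure.infinitePi fun _ : ℕ => ν), ∀ k l : ℕ,
      Tendsto (fun N => orbitAverage G t x N (u k - ψ k l)) atTop (𝓝 0) :=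
    ae_all_iff.2 fun k => ae_all_iff.2 fun l => hψ1 k l x
  filter_upwards [hae] with t ht ⟨i, hi⟩ φ
  rw [Metric.tendsto_nhds]
  intro ε hε
  -- Five errors `η`: two from replacing `φ` by `u k` (orbit average and integral), one from the
  -- null average, two from the tail estimate.
  obtain ⟨η, hη, hηε⟩ : ∃ η : ℝ, 0 < η ∧ 5 * η < ε := ⟨ε / 6, by positivity, by linarith⟩
  obtain ⟨k, hk⟩ := (TopologicalSpace.denseRange_denseSeq C(M, ℝ)).exists_dist_lt φ hη
  rw [dist_eq_norm] at hk
  obtain ⟨l, hl⟩ := exists_nat_one_div_lt hη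
  have h1 := (Metric.tendsto_nhds.1 (ht k l)) η hη
  have h2 := eventually_abs_average_sub_le (u := fun j => ψ k l (perturbedIterate G t j x)) hη
    (i := i) (c := ∫ y, u k y ∂μ)
    fun j hj => (hψ2 k l _ (perturbedIterate_mem hC t hj hi)).trans hl.le
  filter_upwards [h1, h2] with N hN1 hN2
  have e : orbitAverage G t x N φ = orbitAverage G t x N (φ - u k) +
      (orbitAverage G t x N (u k - ψ k l) + orbitAverage G t x N (ψ k l)) := by
    rw [← orbitAverage_add, ← orbitAverage_add]
    congr 1; abel
  have h3 := (abs_orbitAverage_le G t x N (φ - u k)).trans hk.le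
  have h4 : |∫ y, φ y ∂μ - ∫ y, u k y ∂μ| ≤ η := by
    have hi : ∀ φ : C(M, ℝ), Integrable (fun y => φ y) μ := fun φ =>
      Integrable.of_bound φ.continuous.aestronglyMeasurable ‖φ‖
        (ae_of_all _ fun y => φ.norm_coe_le_norm y)
    rw [← integral_sub (hi _) (hi _)]
    have := norm_integral_le_of_norm_le_const (μ := μ) (f := fun y => φ y - u k y) (C := η)
      (ae_of_all _ fun y => ((φ - u k).norm_coe_le_norm y).trans hk.le)
    simpa using this
  rw [Real.dist_eq, sub_zero] at hN1
  change |orbitAverage G t x N (ψ k l) - _| ≤ _ at hN2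
  rw [Real.dist_eq, e]
  rw [abs_le] at h3 h4 hN2
  rw [abs_lt] at hN1 ⊢
  constructor <;> linarith [h3.1, h3.2, h4.1, h4.2, hN2.1, hN2.2, hN1.1, hN1.2]

/-! ### Generic continuity of absolutely continuous transition probabilities -/

theorem exists_isOpen_transferOperator_pow_nearly_constant (m : Measure M) [IsFiniteMeasure m]
    {K : ℕ} (hac : ∀ x, (Measure.infinitePi fun _ : ℕ => ν).map
      (fun t => perturbedIterate G t K x) ≪ m) {O : Set M} (hO : IsOpen O) (hne : O.Nonempty) :
    ∃ V ⊆ O, IsOpen V ∧ V.Nonempty ∧ ∀ ψ : C(M, ℝ), ∀ x ∈ V, ∀ y ∈ V,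
      |(transferOperator G hG ν ^ K) ψ x - (transferOperator G hG ν ^ K) ψ y| ≤ 1 / 2 * ‖ψ‖ := by
  set P := transferOperator G hG ν with hP
  have : Fact ((1 : ℝ≥0∞) ≤ 1) := ⟨le_rfl⟩
  have : Fact ((1 : ℝ≥0∞) ≠ ⊤) := ⟨ENNReal.one_ne_top⟩
  set g := TopologicalSpace.denseSeq (Lp ℝ 1 m)
  -- `A i` collects the points whose `K`-step law is within `1 / 4` of the density `g i`, tested on
  -- continuous functions only. This weak form makes `A i` closed, since each `P ^ K ψ` is
  -- continuous; density of the `g i` in `L¹` makes the `A i` cover `M`.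
  set A : ℕ → Set M := fun i => {x | ∀ ψ : C(M, ℝ), |(P ^ K) ψ x - ∫ y, g i y * ψ y ∂m| ≤
    1 / 4 * ‖ψ‖} with hA
  have hclosed : ∀ i, IsClosed (A i) := fun i => by
    have : A i = ⋂ ψ : C(M, ℝ), {x | |(P ^ K) ψ x - ∫ y, g i y * ψ y ∂m| ≤ 1 / 4 * ‖ψ‖} := by
      ext x; simp [hA]
    rw [this]
    refine isClosed_iInter fun ψ => isClosed_le ?_ continuous_const
    exact (((P ^ K) ψ).continuous.sub continuous_const).abs
  have hcover : ⋃ i, A i = univ := by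
    refine eq_univ_of_forall fun x => ?_
    have hmeas : Continuous fun t => perturbedIterate G t K x :=
      (continuous_perturbedIterate hG K).comp (by fun_prop : Continuous fun t => (t, x))
    set law := (Measure.infinitePi fun _ : ℕ => ν).map (fun t => perturbedIterate G t K x)
      with hlaw
    have : IsProbabilityMeasure law := Measure.isProbabilityMeasure_map hmeas.aemeasurable
    have hp : Integrable (fun y => (law.rnDeriv m y).toReal) m := Measure.integrable_toReal_rnDeriv
    obtain ⟨i, hi⟩ := (TopologicalSpace.denseRange_denseSeq (Lp ℝ 1 m)).exists_dist_lt
      hp.toL1 (by norm_num : (0 : ℝ) < 1 / 4)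
    refine mem_iUnion.2 ⟨i, fun ψ => ?_⟩
    have e1 : (P ^ K) ψ x = ∫ y, (law.rnDeriv m y).toReal * ψ y ∂m := by
      rw [hP, ← integral_perturbedIterate hG ν K ψ x,
        ← integral_map (φ := fun t => perturbedIterate G t K x) (f := fun y => ψ y)
          hmeas.aemeasurable ψ.continuous.aestronglyMeasurable]
      exact (integral_rnDeriv_smul (hac x)).symm
    have hgi : Integrable (g i) m := L1.integrable_coeFn (g i)
    have hbdd : ∀ q : M → ℝ, Integrable q m → Integrable (fun y => q y * ψ y) m := fun q hq =>
      hq.mul_bdd (c := ‖ψ‖) ψ.continuous.aestronglyMeasurable (ae_of_all _ fun y => ψ.norm_coe_le_norm y)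
    rw [e1, ← integral_sub (hbdd _ hp) (hbdd _ hgi)]
    have hnorm : ∫ y, ‖(law.rnDeriv m y).toReal - g i y‖ ∂m ≤ 1 / 4 := by
      rw [dist_eq_norm, L1.norm_eq_integral_norm] at hi
      refine le_trans (le_of_eq (integral_congr_ae ?_)) hi.le
      filter_upwards [Lp.coeFn_sub hp.toL1 (g i), hp.coeFn_toL1] with y h1 h2
      rw [h1, Pi.sub_apply, h2]
    rw [← Real.norm_eq_abs]
    refine le_trans (norm_integral_le_of_norm_le ((hp.sub hgi).norm.mul_const ‖ψ‖)
      (ae_of_all _ fun y => ?_)) ?_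
    · rw [Pi.sub_apply, ← sub_mul, norm_mul]
      exact mul_le_mul_of_nonneg_left (ψ.norm_coe_le_norm y) (norm_nonneg _)
    · rw [integral_mul_const]
      exact mul_le_mul_of_nonneg_right hnorm (norm_nonneg _)
  obtain ⟨y, hyO, hy⟩ := (dense_iUnion_interior_of_closed hclosed hcover).inter_open_nonempty O hO hne
  obtain ⟨i, hi⟩ := mem_iUnion.1 hy
  refine ⟨O ∩ interior (A i), inter_subset_left, hO.inter isOpen_interior, ⟨y, hyO, hi⟩,
    fun ψ x hx z hz => ?_⟩
  have h1 := abs_le.1 (interior_subset hx.2 ψ)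
  have h2 := abs_le.1 (interior_subset hz.2 ψ)
  rw [abs_le]
  constructor <;> linarith [h1.1, h1.2, h2.1, h2.2]

/-! ### The measure that governs the random orbits in an invariant region -/

theorem exists_measure_governing {C : Set M} (hCc : IsCompact C) (hne : C.Nonempty)
    (hC : ∀ x ∈ C, ∀ s, G x s ∈ C) (m : Measure M) [IsFiniteMeasure m]
    {K : ℕ} (hac : ∀ x, (Measure.infinitePi fun _ : ℕ => ν).map
      (fun t => perturbedIterate G t K x) ≪ m) {O : Set M} (hO : IsOpen O) (hOne : O.Nonempty)
    (hreach : ∀ v ∈ O, ∀ χ : C(M, ℝ), (∀ x, 0 ≤ χ x) → 0 < χ v → ∀ x ∈ C,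
      ∃ N, 0 < (transferOperator G hG ν ^ N) χ x) :
    ∃ μ : Measure M, IsProbabilityMeasure μ ∧
      (∀ x, ∀ᵐ t ∂(Measure.infinitePi fun _ : ℕ => ν), (∃ i, perturbedIterate G t i x ∈ C) →
        ∀ φ : C(M, ℝ), Tendsto (fun N => orbitAverage G t x N φ) atTop (𝓝 (∫ y, φ y ∂μ))) ∧
      ∀ v ∈ O, ∀ χ : C(M, ℝ), (∀ x, 0 ≤ χ x) → 0 < χ v → 0 < ∫ y, χ y ∂μ := by
  set P := transferOperator G hG ν with hP
  obtain ⟨V, hVO, hV, ⟨v, hv⟩, hosc⟩ :=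
    exists_isOpen_transferOperator_pow_nearly_constant hG ν m hac hO hOne
  obtain ⟨χ, hχV, hχv, hχ⟩ := exists_continuous_zero_one_of_isClosed hV.isClosed_compl
    (isClosed_singleton (x := v)) (by simpa using hv)
  have hχV' : ∀ x, χ x ≠ 0 → x ∈ V := fun x hx => by
    by_contra h
    exact hx (hχV h)
  have hχv' : χ v = 1 := hχv rfl
  obtain ⟨R, hR, δ, hδ0, hδ⟩ := exists_le_sum_transferOperator_pow hG ν hCc (fun x => (hχ x).1)
    (hreach v (hVO hv) χ (fun x => (hχ x).1) (by rw [hχv']; exact one_pos))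
  have hR' : (0 : ℝ) < R := by exact_mod_cast hR
  -- shrink `δ` so that the contraction rate is nonnegative
  set δ' := min δ 1 with hδ'
  have hδ'0 : 0 < δ' := lt_min hδ0 one_pos
  have hδ'1 : δ' / (4 * R) ≤ 1 := by
    have : (1 : ℝ) ≤ R := by exact_mod_cast hR
    rw [div_le_one (by positivity)]
    linarith [min_le_right δ 1]
  obtain ⟨μ, hμ, hlim⟩ := exists_measure_of_oscillation_contraction hne
    (S := (R : ℝ)⁻¹ • ∑ j ∈ Finset.range R, P ^ (j + K)) (r := 1 - δ' / (4 * R))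
    (sub_nonneg.2 hδ'1) (by have : 0 < δ' / (4 * R) := by positivity
                            linarith)
    (fun ψ a b hψ => exists_bounds_average_transferOperator hG ν hC hR (fun x => (hχ x).2) hne
      hδ'0 (fun x hx => (min_le_left _ _).trans (hδ x hx))
      (fun ψ x y hx hy => hosc ψ x (hχV' x hx) y (hχV' y hy)) hψ)
  have hgov := ae_tendsto_orbitAverage ν hC μ fun φ η hη => by
    obtain ⟨k, hk⟩ := hlim φ η hη
    exact ⟨_, fun x => sub_average_transferOperator_pow_mem hG ν hR K k φ x, hk⟩
  refine ⟨μ, hμ, hgov, fun v hv χ hχ0 hχv => ?_⟩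
  obtain ⟨R, hR, δ, hδ0, hδ⟩ := exists_le_sum_transferOperator_pow hG ν hCc hχ0
    (hreach v hv χ hχ0 hχv)
  obtain ⟨x, hx⟩ := hne
  -- Averages of `R χ` and of `∑ P ^ j χ` agree in the limit, and the latter sum is at least `δ`
  -- along an orbit in `C`; hence `R ∫ χ dμ ≥ δ`.
  have hnull : ∀ᵐ t ∂(Measure.infinitePi fun _ : ℕ => ν), Tendsto (fun N => orbitAverage G t x N
      (∑ j ∈ Finset.range R, (χ - (P ^ j) χ))) atTop (𝓝 0) :=
    Submodule.sum_mem (averageNullSubmodule G ν x) fun j _ =>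
      sub_transferOperator_pow_mem hG ν χ x j
  obtain ⟨t, ht1, ht2⟩ := (hnull.and (hgov x)).exists
  have hlim := ((ht2 ⟨0, hx⟩ χ).const_mul (R : ℝ)).sub ht1
  have hR' : (0 : ℝ) < R := by exact_mod_cast hR
  have : δ ≤ R * ∫ y, χ y ∂μ - 0 := by
    refine ge_of_tendsto hlim ?_
    filter_upwards [eventually_gt_atTop 0] with N hN
    have hN' : (0 : ℝ) < N := by exact_mod_cast hN
    rw [orbitAverage, orbitAverage, mul_left_comm, ← mul_sub, one_div, le_inv_mul_iff₀ hN',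
      Finset.mul_sum, ← Finset.sum_sub_distrib]
    calc (N : ℝ) * δ = ∑ j ∈ Finset.range N, δ := by simp
      _ ≤ _ := Finset.sum_le_sum fun j _ => by
        have := hδ _ (perturbedIterate_mem hC t (Nat.zero_le j) (x := x) hx)
        simpa [ContinuousMap.sum_apply] using this
  rw [sub_zero] at this
  exact pos_of_mul_pos_right (hδ0.trans_le this) hR'.le

end Convergence

/-! ### Attractors and their trapping regions -/

theorem iterate_image_eq_of_image_eq {f : M → M} {Λ : Set M} (h : f '' Λ = Λ) (k : ℕ) :
    f^[k] '' Λ = Λ := by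
  induction k with
  | zero => simp
  | succ k ih => rw [Function.iterate_succ, image_comp, h, ih]

section Topological

variable [TopologicalSpace M] {f : M → M} {Λ : Set M}

/-- Since `f^[L]` maps `Λ` onto itself, it carries a dense orbit to a dense orbit tail. -/
theorem subset_closure_iterate_tail (hf : Continuous f) (h : f '' Λ = Λ) {z : M}
    (hz : closure {y | ∃ k ≥ 1, y = f^[k] z} = Λ) (L : ℕ) :
    Λ ⊆ closure {y | ∃ k ≥ L, y = f^[k] z} := by
  intro w hw
  rw [← iterate_image_eq_of_image_eq h L] at hw
  obtain ⟨w', hw', rfl⟩ := hw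
  rw [← hz] at hw'
  refine closure_mono ?_ (image_closure_subset_closure_image (hf.iterate L) (mem_image_of_mem _ hw'))
  rintro _ ⟨_, ⟨k, -, rfl⟩, rfl⟩
  exact ⟨L + k, Nat.le_add_right _ _, (Function.iterate_add_apply f L k z).symm⟩

theorem IsTrappingRegion.iterate_image_antitone {U : Set M} (h : IsTrappingRegion f Λ U) :
    Antitone fun k : ℕ => f^[k] '' closure U := by
  refine antitone_nat_of_succ_le fun k => ?_
  rw [Function.iterate_succ, image_comp]
  exact image_mono (h.trapping.trans subset_closure)

theorem IsTrappingRegion.exists_iterate_image_subset [CompactSpace M] [T2Space M]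
    (hf : Continuous f) {U : Set M} (h : IsTrappingRegion f Λ U) {O : Set M} (hO : IsOpen O)
    (hΛO : Λ ⊆ O) : ∃ k, ∀ j ≥ k, f^[j] '' closure U ⊆ O := by
  have hanti := h.iterate_image_antitone
  obtain ⟨k, hk⟩ := exists_subset_nhds_of_isCompact
    (V := fun k : ℕ => f^[k + 1] '' closure U)
    (directed_of_isDirected_le fun i j hij => hanti (Nat.succ_le_succ hij))
    (fun k => (isClosed_closure.isCompact).image (hf.iterate _)) (U := O) (fun x hx => by
      refine hO.mem_nhds (hΛO ?_)
      rw [h.eq_iInter]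
      simp only [mem_iInter] at hx ⊢
      intro k hk
      obtain ⟨k, rfl⟩ := Nat.exists_eq_add_of_le' hk
      exact hx k)
  exact ⟨k + 1, fun j hj => (hanti hj).trans hk⟩

/-- An attractor has arbitrarily small open trapping regions. -/
theorem IsAttractor.exists_isOpen_isTrappingRegion [CompactSpace M] [T2Space M]
    (hf : Continuous f) (hΛ : IsAttractor f Λ) {O : Set M} (hO : IsOpen O) (hΛO : Λ ⊆ O) :
    ∃ U, IsOpen U ∧ closure U ⊆ O ∧ IsTrappingRegion f Λ U := by
  obtain ⟨U₀, hU₀⟩ := hΛ.trapping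
  have hinv := iterate_image_eq_of_image_eq hΛ.invariant
  obtain ⟨u, hu0, hu1, -⟩ := exists_continuous_zero_one_of_isClosed hΛ.isCompact.isClosed
    (hO.inter (isOpen_interior (s := U₀))).isClosed_compl
    (disjoint_compl_right_iff_subset.2
      (subset_inter hΛO (subset_interior_iff_mem_nhdsSet.2 hU₀.nhds)))
  obtain ⟨k, hk⟩ := hU₀.exists_iterate_image_subset hf
    (isOpen_lt u.continuous (continuous_const (y := (1 / 3 : ℝ))))
    (fun x hx => by
      have : u x = 0 := hu0 hx
      simp [this])
  -- Strictly decreasing levels from `2 / 3`, above `1 / 3` up to `j = k`. On `closure U`, the bound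
  -- at time `j + 1` gives the strict one required at time `j` of the image; for `j = k` the bound
  -- comes from `f^[k + 1] '' closure U₀ ⊆ {u < 1 / 3}`.
  set s : ℕ → ℝ := fun j => 2 / 3 - j / (3 * (k + 1 : ℝ)) with hs
  have hk0 : (0 : ℝ) < k + 1 := by positivity
  have hs_anti : ∀ j, s (j + 1) < s j := fun j => by
    simp only [hs]; push_cast
    have : (j : ℝ) / (3 * (k + 1)) < (j + 1) / (3 * (k + 1)) := by gcongr; linarith
    linarith
  have hs_gt : ∀ j ≤ k, 1 / 3 < s j := fun j hj => by
    have hj' : (j : ℝ) ≤ k := by exact_mod_cast hj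
    have : (j : ℝ) / (3 * (k + 1)) < 1 / 3 := by
      rw [div_lt_div_iff₀ (by positivity) (by norm_num)]; linarith
    simp only [hs]; linarith
  set U : Set M := ⋂ j ∈ Finset.range (k + 1), {x | u (f^[j] x) < s j} with hU
  have hUopen : IsOpen U := isOpen_biInter_finset fun j _ =>
    isOpen_lt (u.continuous.comp (hf.iterate j)) continuous_const
  have hUcl : ∀ x ∈ closure U, ∀ j ≤ k, u (f^[j] x) ≤ s j := fun x hx j hj => by
    refine closure_minimal (t := {x | u (f^[j] x) ≤ s j}) (fun y hy => ?_)
      (isClosed_le (u.continuous.comp (hf.iterate j)) continuous_const) hx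
    have h : u (f^[j] y) < s j := mem_iInter₂.1 hy j (Finset.mem_range.2 (Nat.lt_succ_of_le hj))
    exact h.le
  have hsub : closure U ⊆ O ∩ interior U₀ := fun x hx => by
    by_contra h
    have h1 : u x = 1 := hu1 h
    have h2 := hUcl x hx 0 (Nat.zero_le k)
    simp only [Function.iterate_zero, id_eq, h1, hs, Nat.cast_zero, zero_div] at h2
    norm_num at h2
  have hΛU : Λ ⊆ U := fun x hx => mem_iInter₂.2 fun j hj => by
    have h1 : f^[j] x ∈ Λ := by
      rw [← hinv j]
      exact mem_image_of_mem _ hx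
    have h2 : u (f^[j] x) = 0 := hu0 h1
    have h3 := hs_gt j (Nat.le_of_lt_succ (Finset.mem_range.1 hj))
    rw [mem_ofPred_eq, h2]
    linarith
  have hclU : closure U ⊆ closure U₀ :=
    hsub.trans (inter_subset_right.trans (interior_subset.trans subset_closure))
  refine ⟨U, hUopen, hsub.trans inter_subset_left, hUopen.mem_nhdsSet.2 hΛU, ?_, ?_⟩
  · rintro _ ⟨x, hx, rfl⟩
    refine mem_iInter₂.2 fun j hj => ?_
    have hj' := Nat.le_of_lt_succ (Finset.mem_range.1 hj)
    rw [mem_ofPred_eq, ← Function.iterate_succ_apply]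
    rcases hj'.eq_or_lt with rfl | hlt
    · have : f^[j + 1] x ∈ {x | u x < 1 / 3} :=
        hk (j + 1) (Nat.le_succ j) (mem_image_of_mem _ (hclU hx))
      exact lt_trans this (hs_gt j le_rfl)
    · exact (hUcl x hx (j + 1) hlt).trans_lt (hs_anti j)
  · refine Subset.antisymm (fun x hx => mem_iInter₂.2 fun j _ => ?_) ?_
    · rw [← hinv j] at hx
      exact image_mono (hΛU.trans subset_closure) hx
    · rw [hU₀.eq_iInter]
      exact iInter₂_mono fun j _ => image_mono hclU

end Topological

/-- Small perturbations of a continuous map preserve trapping. -/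
theorem exists_noise_level_mapsTo [TopologicalSpace M] {E : Type*} [NormedAddCommGroup E]
    {F : M → E → M} (hF : ContinuousOn (fun q : M × E => F q.1 q.2) (univ ×ˢ Metric.ball 0 1))
    {C U : Set M} (hC : IsCompact C) (hU : IsOpen U) (h0 : ∀ x ∈ C, F x 0 ∈ U) :
    ∃ ε₀ ∈ Ioo (0 : ℝ) 1, ∀ x ∈ C, ∀ t, ‖t‖ ≤ ε₀ → F x t ∈ U := by
  have hW := hF.isOpen_inter_preimage (isOpen_univ.prod Metric.isOpen_ball) hU
  obtain ⟨A, V, -, hV, hCA, h0V, hAV⟩ := generalized_tube_lemma hC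
    (isCompact_singleton (x := (0 : E))) hW (by
      rintro ⟨x, t⟩ ⟨hx, ht⟩
      obtain rfl : t = 0 := ht
      exact ⟨⟨mem_univ _, by simp⟩, h0 x hx⟩)
  obtain ⟨r, hr, hrV⟩ := Metric.isOpen_iff.1 hV 0 (h0V rfl)
  refine ⟨min (r / 2) (1 / 2), ⟨by positivity, ?_⟩, fun x hx t ht => ?_⟩
  · exact (min_le_right _ _).trans_lt (by norm_num)
  · have : t ∈ Metric.ball (0 : E) r := by
      rw [mem_ball_zero_iff]
      linarith [min_le_left (r / 2) (1 / 2 : ℝ)]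
    exact (hAV (mk_mem_prod (hCA hx) (hrV this))).2

/-! ### The noise measures -/

section Noise

theorem isProbabilityMeasure_noiseMeasure {ε : ℝ} (hε : 0 < ε) :
    IsProbabilityMeasure (noiseMeasure n ε) := by
  refine ProbabilityTheory.cond_isProbabilityMeasure_of_finite ?_ ?_
  · exact (Metric.measure_closedBall_pos volume _ hε).ne'
  · exact (isCompact_closedBall _ _).measure_lt_top.ne

theorem ae_noiseMeasure_norm_le (ε : ℝ) : ∀ᵐ t ∂(noiseMeasure n ε), ‖t‖ ≤ ε := by
  have := ProbabilityTheory.ae_cond_mem (μ := (volume : Measure (EuclideanSpace ℝ (Fin n))))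
    (Metric.isClosed_closedBall (x := 0) (ε := ε)).measurableSet
  filter_upwards [this] with t ht
  simpa using ht

/-- Boundary points count too, as limits of interior ones; the spreading hypothesis allows noise of
norm exactly `ε`. -/
theorem mem_support_noiseMeasure {ε : ℝ} (hε : 0 < ε) {s : EuclideanSpace ℝ (Fin n)}
    (hs : ‖s‖ ≤ ε) : s ∈ (noiseMeasure n ε).support := by
  rw [Measure.mem_support_iff_forall]
  intro O hO
  have h1 : s ∈ closure (Metric.ball (0 : EuclideanSpace ℝ (Fin n)) ε) := by
    rw [closure_ball _ hε.ne']
    simpa using hs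
  obtain ⟨W, hWO, hW, hsW⟩ := mem_nhds_iff.1 hO
  have h2 : (W ∩ Metric.ball (0 : EuclideanSpace ℝ (Fin n)) ε).Nonempty :=
    mem_closure_iff.1 h1 W hW hsW
  have h3 : 0 < volume (Metric.closedBall (0 : EuclideanSpace ℝ (Fin n)) ε ∩ O) :=
    ((hW.inter Metric.isOpen_ball).measure_pos volume h2).trans_le (measure_mono fun x hx =>
      ⟨Metric.ball_subset_closedBall hx.2, hWO hx.1⟩)
  rw [noiseMeasure, ProbabilityTheory.cond_apply Metric.isClosed_closedBall.measurableSet]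
  exact ENNReal.mul_pos
    (ENNReal.inv_ne_zero.2 (isCompact_closedBall _ _).measure_lt_top.ne) h3.ne'

theorem ae_noiseProduct_mem_perturbationSpace {ε : ℝ} (hε : 0 < ε) :
    ∀ᵐ t ∂(noiseProduct n ε), t ∈ perturbationSpace n ε := by
  have := isProbabilityMeasure_noiseMeasure (n := n) hε
  refine ae_all_iff.2 fun j => ?_
  exact (measurePreserving_eval_infinitePi (fun _ : ℕ => noiseMeasure n ε) j).quasiMeasurePreserving.ae
    (ae_noiseMeasure_norm_le ε)

/-- A retraction onto the closed ball of radius `ε` around `0`. -/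
def ballRetraction (ε : ℝ) (t : EuclideanSpace ℝ (Fin n)) : EuclideanSpace ℝ (Fin n) :=
  (ε / max ε ‖t‖) • t

theorem continuous_ballRetraction {ε : ℝ} (hε : 0 < ε) :
    Continuous (ballRetraction (n := n) ε) := by
  refine Continuous.smul (continuous_const.div (continuous_const.max continuous_norm) fun t => ?_) continuous_id
  exact (hε.trans_le (le_max_left _ _)).ne'

theorem norm_ballRetraction_le {ε : ℝ} (hε : 0 < ε) (t : EuclideanSpace ℝ (Fin n)) :
    ‖ballRetraction ε t‖ ≤ ε := by
  have h : 0 < max ε ‖t‖ := hε.trans_le (le_max_left _ _)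
  rw [ballRetraction, norm_smul, Real.norm_of_nonneg (by positivity), div_mul_eq_mul_div,
    div_le_iff₀ h]
  exact mul_le_mul_of_nonneg_left (le_max_right _ _) hε.le

theorem ballRetraction_of_norm_le {ε : ℝ} (hε : 0 < ε) {t : EuclideanSpace ℝ (Fin n)}
    (ht : ‖t‖ ≤ ε) : ballRetraction ε t = t := by
  rw [ballRetraction, max_eq_left ht, div_self hε.ne', one_smul]

end Noise

/-! ### Reaching a neighborhood of the attractor -/

section Reach

variable [EMetricSpace M] [CompactSpace M] {G : M → EuclideanSpace ℝ (Fin n) → M}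
  (hG : Continuous (Function.uncurry G))
  (ν : Measure (EuclideanSpace ℝ (Fin n))) [IsProbabilityMeasure ν]

theorem exists_transferOperator_pow_pos {f : M → M} (hf : Continuous f) (h0 : ∀ x, G x 0 = f x)
    (hν : (0 : EuclideanSpace ℝ (Fin n)) ∈ ν.support) {Λ : Set M} (hΛ : IsAttractor f Λ)
    {C : Set M} {K : ℕ} {ξ : ℝ≥0∞} (hξ : 0 < ξ)
    (hspread : ∀ x, ∀ j ≥ K, ∀ y ∈ Metric.eball (f^[j] x) ξ,
      ∃ t : ℕ → EuclideanSpace ℝ (Fin n), (∀ i, t i ∈ ν.support) ∧ perturbedIterate G t j x = y)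
    (hC : ∀ O, IsOpen O → Λ ⊆ O → ∃ k, ∀ j ≥ k, f^[j] '' C ⊆ O)
    {v w : M} (hw : w ∈ Λ) (hv : v ∈ Metric.eball w ξ) {χ : C(M, ℝ)} (hχ0 : ∀ x, 0 ≤ χ x)
    (hχ : 0 < χ v) {x : M} (hx : x ∈ C) : ∃ N, 0 < (transferOperator G hG ν ^ N) χ x := by
  obtain ⟨z, -, hz⟩ := hΛ.transitive
  have htail := subset_closure_iterate_tail hf hΛ.invariant hz
  -- orbit points of `z` lead to `v`
  have horbit : ∀ j, ∃ N, 0 < (transferOperator G hG ν ^ N) χ (f^[j] z) := by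
    intro j
    -- The return time is at least `j + K`, so that the last `K` steps can be replaced by noise
    -- steering exactly to `v`, after zero noise up to then.
    obtain ⟨_, hl, l, hjl, rfl⟩ := mem_closure_iff.1 (htail (j + K) hw) (Metric.eball v ξ)
      Metric.isOpen_eball (by rwa [Metric.mem_eball_comm])
    obtain ⟨i, rfl⟩ := Nat.exists_eq_add_of_le hjl
    have e : f^[j + K + i] z = f^[K] (f^[i] (f^[j] z)) := by
      rw [show j + K + i = K + (i + j) by omega, Function.iterate_add_apply,
        Function.iterate_add_apply]
    rw [e, Metric.mem_eball_comm] at hl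
    obtain ⟨t, ht, htv⟩ := hspread _ K le_rfl v hl
    have h1 : 0 < (transferOperator G hG ν ^ K) χ (f^[i] (f^[j] z)) :=
      transferOperator_pow_pos hG ν hχ0 ht K (by rwa [htv])
    refine ⟨i + K, transferOperator_pow_add_pos hG ν hχ0 (t := fun _ => 0) (fun _ => hν) i K ?_⟩
    rwa [perturbedIterate_zero_noise h0]
  obtain ⟨k, hk⟩ := hC (⋃ y ∈ Λ, Metric.eball y ξ)
    (isOpen_biUnion fun y _ => Metric.isOpen_eball)
    (fun y hy => mem_biUnion hy (Metric.mem_eball_self hξ))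
  obtain ⟨y, hy, hxy⟩ := mem_iUnion₂.1 (hk (max k K) (le_max_left _ _) (mem_image_of_mem _ hx))
  obtain ⟨_, hl, l, -, rfl⟩ := mem_closure_iff.1 (htail 0 hy) (Metric.eball (f^[max k K] x) ξ)
    Metric.isOpen_eball (by rwa [Metric.mem_eball_comm])
  obtain ⟨t, ht, htl⟩ := hspread x _ (le_max_right k K) _ hl
  obtain ⟨N, hN⟩ := horbit l
  exact ⟨max k K + N, transferOperator_pow_add_pos hG ν hχ0 ht _ N (by rwa [htl])⟩

end Reach

/-! ### The measure at a fixed noise level -/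

/-- The total mass is at most `1` even if `m univ` is `0` or `⊤`, so finiteness of the Riemannian
volume is not needed. -/
theorem isFiniteMeasure_inv_smul_univ [MeasurableSpace M] (m : Measure M) :
    IsFiniteMeasure ((m univ)⁻¹ • m) :=
  ⟨by
    rw [Measure.smul_apply, smul_eq_mul]
    exact ENNReal.inv_mul_le_one _ |>.trans_lt ENNReal.one_lt_top⟩

theorem eq_of_tendsto_averages [EMetricSpace M] [MeasurableSpace M] [BorelSpace M] {μ μ' : Measure M}
    [IsProbabilityMeasure μ] [IsProbabilityMeasure μ'] {u : ℕ → M}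
    (h : ∀ φ : C(M, ℝ), Tendsto (fun N : ℕ => (1 / (N : ℝ)) * ∑ j ∈ Finset.range N, φ (u j))
      atTop (𝓝 (∫ y, φ y ∂μ)))
    (h' : ∀ φ : C(M, ℝ), Tendsto (fun N : ℕ => (1 / (N : ℝ)) * ∑ j ∈ Finset.range N, φ (u j))
      atTop (𝓝 (∫ y, φ y ∂μ'))) : μ' = μ :=
  ext_of_forall_integral_eq_of_IsFiniteMeasure fun φ =>
    tendsto_nhds_unique (h' φ.toContinuousMap) (h φ.toContinuousMap)

section Level

variable [EMetricSpace M] [CompactSpace M] [MeasurableSpace M] [BorelSpace M]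

theorem exists_measure_governing_random_orbits {f : M → M} (hf : Continuous f)
    {F : M → EuclideanSpace ℝ (Fin n) → M}
    (hFc : ContinuousOn (fun q : M × EuclideanSpace ℝ (Fin n) => F q.1 q.2)
      (univ ×ˢ Metric.ball 0 1))
    (h0 : ∀ x, F x 0 = f x) (m : Measure M) [IsFiniteMeasure m] {Λ U : Set M}
    (hΛ : IsAttractor f Λ) (hU : IsOpen U) (hUt : IsTrappingRegion f Λ U)
    {ε : ℝ} (hε0 : 0 < ε) (hε1 : ε < 1)
    (htrap : ∀ x ∈ closure U, ∀ t, ‖t‖ ≤ ε → F x t ∈ U)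
    {K : ℕ} {ξ : ℝ≥0∞} (hξ : 0 < ξ)
    (hspread : ∀ x : M, ∀ j ≥ K, Metric.eball (f^[j] x) ξ ⊆
      (fun t => perturbedIterate F t j x) '' perturbationSpace n ε)
    (hac : ∀ x : M, ∀ k ≥ K, (noiseProduct n ε).map (fun t => perturbedIterate F t k x) ≪ m) :
    m U ≠ 0 ∧ ∃ μ : Measure M, IsProbabilityMeasure μ ∧ Λ ⊆ μ.support ∧
      ∀ x, ∀ᵐ t ∂(noiseProduct n ε), (∃ i, perturbedIterate F t i x ∈ closure U) →
        ∀ φ : C(M, ℝ), Tendsto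
          (fun N : ℕ => (1 / (N : ℝ)) * ∑ j ∈ Finset.range N, φ (perturbedIterate F t j x))
          atTop (𝓝 (∫ y, φ y ∂μ)) := by
  have hprob := isProbabilityMeasure_noiseMeasure (n := n) hε0
  have hprob' : IsProbabilityMeasure (noiseProduct n ε) := by
    rw [noiseProduct]; infer_instance
  -- `F` is controlled only for noise in the unit ball. Clipping gives a globally continuous `G`
  -- that keeps `closure U` invariant for every noise value and has the same orbits on `Δ_ε`.
  set G : M → EuclideanSpace ℝ (Fin n) → M := fun x t => F x (ballRetraction ε t) with hGdef
  have hG : Continuous (Function.uncurry G) := by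
    refine hFc.comp_continuous (f := fun q : M × EuclideanSpace ℝ (Fin n) =>
      (q.1, ballRetraction ε q.2))
      (continuous_fst.prodMk ((continuous_ballRetraction hε0).comp continuous_snd)) fun q => ?_
    exact ⟨mem_univ _, mem_ball_zero_iff.2 ((norm_ballRetraction_le hε0 _).trans_lt hε1)⟩
  have hFG : ∀ t ∈ perturbationSpace n ε, ∀ j x,
      perturbedIterate F t j x = perturbedIterate G t j x := fun t ht j x =>
    perturbedIterate_congr (fun y i => by
      simp only [hGdef, ballRetraction_of_norm_le hε0 (ht i)]) j x
  have hGC : ∀ x ∈ closure U, ∀ s, G x s ∈ closure U := fun x hx s =>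
    subset_closure (htrap x hx _ (norm_ballRetraction_le hε0 s))
  have hG0 : ∀ x, G x 0 = f x := fun x => by
    simp only [hGdef, ballRetraction, smul_zero, h0]
  have hΛU : Λ ⊆ U := subset_of_mem_nhdsSet hUt.nhds
  obtain ⟨z, hzΛ, -⟩ := hΛ.transitive
  have hmapG : ∀ x k, (noiseProduct n ε).map (fun t => perturbedIterate F t k x) =
      (noiseProduct n ε).map (fun t => perturbedIterate G t k x) := fun x k =>
    Measure.map_congr ((ae_noiseProduct_mem_perturbationSpace hε0).mono fun t ht => hFG t ht k x)
  have hmeasG : ∀ x k, Continuous fun t => perturbedIterate G t k x := fun x k =>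
    (continuous_perturbedIterate hG k).comp (by fun_prop : Continuous fun t => (t, x))
  refine ⟨fun hmU => ?_, ?_⟩
  -- If `U` were null, absolute continuity would give it probability zero after `K` steps, although
  -- orbits from `z` never leave `U`.
  · have h1 := hac z K le_rfl hmU
    rw [hmapG, Measure.map_apply (hmeasG z K).measurable hU.measurableSet] at h1
    have h2 : (fun t => perturbedIterate G t K z) ⁻¹' U = univ := by
      refine eq_univ_of_forall fun t => ?_
      refine perturbedIterate_mem (C := U) (fun x hx s => ?_) t (Nat.zero_le K) (hΛU hzΛ)
      exact htrap x (subset_closure hx) _ (norm_ballRetraction_le hε0 s)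
    rw [h2, measure_univ] at h1
    exact one_ne_zero h1
  have hspreadG : ∀ x, ∀ j ≥ K, ∀ y ∈ Metric.eball (f^[j] x) ξ,
      ∃ t : ℕ → EuclideanSpace ℝ (Fin n), (∀ i, t i ∈ (noiseMeasure n ε).support) ∧
        perturbedIterate G t j x = y := by
    intro x j hj y hy
    obtain ⟨t, ht, rfl⟩ := hspread x j hj hy
    exact ⟨t, fun i => mem_support_noiseMeasure hε0 (ht i), (hFG t ht j x).symm⟩
  obtain ⟨μ, hμ, hgov, hpos⟩ := exists_measure_governing hG (noiseMeasure n ε)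
    isClosed_closure.isCompact ⟨z, subset_closure (hΛU hzΛ)⟩ hGC m (K := K)
    (fun x => by
      have := hac x K le_rfl
      rwa [hmapG] at this)
    (O := ⋃ w ∈ Λ, Metric.eball w ξ) (isOpen_biUnion fun y _ => Metric.isOpen_eball)
    ⟨z, mem_biUnion hzΛ (Metric.mem_eball_self hξ)⟩
    (fun v hv χ hχ0 hχ x hx => by
      obtain ⟨w, hw, hvw⟩ := mem_iUnion₂.1 hv
      exact exists_transferOperator_pow_pos hG _ hf hG0
        (mem_support_noiseMeasure hε0 (by simpa using hε0.le)) hΛ hξ hspreadG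
        (fun O hO hΛO => hUt.exists_iterate_image_subset hf hO hΛO) hw hvw hχ0 hχ hx)
  refine ⟨μ, hμ, fun w hw => ?_, fun x => ?_⟩
  · rw [Measure.mem_support_iff_forall]
    intro O hO
    obtain ⟨V, hVO, hV, hwV⟩ := mem_nhds_iff.1 hO
    obtain ⟨χ, hχV, hχw, hχ⟩ := exists_continuous_zero_one_of_isClosed hV.isClosed_compl
      (isClosed_singleton (x := w)) (by simpa using hwV)
    have hχw' : χ w = 1 := hχw rfl
    have h1 := hpos w (mem_biUnion hw (Metric.mem_eball_self hξ)) χ (fun x => (hχ x).1)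
      (by rw [hχw']; exact one_pos)
    rw [integral_pos_iff_support_of_nonneg (fun x => (hχ x).1)
      (Integrable.of_bound χ.continuous.aestronglyMeasurable ‖χ‖
        (ae_of_all _ fun y => χ.norm_coe_le_norm y))] at h1
    refine h1.trans_le (measure_mono fun y hy => hVO ?_)
    by_contra h
    exact hy (hχV h)
  · filter_upwards [hgov x, ae_noiseProduct_mem_perturbationSpace hε0] with t ht htΔ
    simp only [hFG t htΔ]
    exact ht

/-- A bump function vanishing on `D` sees only the initial point of the orbit, so its averages tend
to `0`. Allowing `u 0 ∉ D` lets `D` be an image under one step of the dynamics. -/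
theorem support_subset_of_tendsto_averages {μ : Measure M} [IsProbabilityMeasure μ] {u : ℕ → M}
    (h : ∀ φ : C(M, ℝ), Tendsto (fun N : ℕ => (1 / (N : ℝ)) * ∑ j ∈ Finset.range N, φ (u j))
      atTop (𝓝 (∫ y, φ y ∂μ))) {D : Set M} (hD : IsClosed D) (hu : ∀ j ≥ 1, u j ∈ D) :
    μ.support ⊆ D := by
  intro w hw
  by_contra hwD
  obtain ⟨χ, hχD, hχw, hχ⟩ := exists_continuous_zero_one_of_isClosed hD
    (isClosed_singleton (x := w)) (by simpa using hwD)
  have hχw' : χ w = 1 := hχw rfl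
  have hint : ∫ y, χ y ∂μ = 0 := by
    refine tendsto_nhds_unique (h χ) ?_
    refine (tendsto_const_div_atTop_nhds_zero_nat (χ (u 0))).congr' ?_
    filter_upwards [eventually_gt_atTop 0] with N hN
    rw [Finset.sum_eq_single 0]
    · ring
    · exact fun j _ hj => hχD (hu j (Nat.one_le_iff_ne_zero.2 hj))
    · intro h
      exact absurd (Finset.mem_range.2 hN) h
  have hpos : 0 < ∫ y, χ y ∂μ := by
    rw [integral_pos_iff_support_of_nonneg (fun x => (hχ x).1)
      (Integrable.of_bound χ.continuous.aestronglyMeasurable ‖χ‖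
        (ae_of_all _ fun y => χ.norm_coe_le_norm y))]
    refine (Measure.mem_support_iff_forall w).1 hw _ (χ.continuous.isOpen_support.mem_nhds ?_)
    rw [Function.mem_support, hχw']
    exact one_ne_zero
  exact hpos.ne' hint

theorem exists_mem_of_tendsto_averages {μ : Measure M} [IsProbabilityMeasure μ] {u : ℕ → M}
    (h : ∀ φ : C(M, ℝ), Tendsto (fun N : ℕ => (1 / (N : ℝ)) * ∑ j ∈ Finset.range N, φ (u j))
      atTop (𝓝 (∫ y, φ y ∂μ))) {U : Set M} (hU : IsOpen U) (hμU : μ.support ⊆ U) :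
    ∃ j, u j ∈ U := by
  by_contra! hu
  have hsub := support_subset_of_tendsto_averages h hU.isClosed_compl fun j _ => hu j
  obtain ⟨w, hw⟩ := Measure.nonempty_support (IsProbabilityMeasure.ne_zero μ)
  exact hsub hw (hμU hw)

end Level

theorem perturbedIterate_mem_of_mapsTo {F : M → EuclideanSpace ℝ (Fin n) → M} {C : Set M} {ε : ℝ}
    (hC : ∀ x ∈ C, ∀ t, ‖t‖ ≤ ε → F x t ∈ C) {t : ℕ → EuclideanSpace ℝ (Fin n)}
    (ht : t ∈ perturbationSpace n ε) {x : M} (hx : x ∈ C) (j : ℕ) :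
    perturbedIterate F t j x ∈ C := by
  induction j with
  | zero => exact hx
  | succ j ih => exact hC _ ih _ (ht j)

end

/-! ### The theorem for all small noise levels -/

theorem mainTheorem3 {d n : ℕ} {M : Type*} [EMetricSpace M] [CompactSpace M]
    [ChartedSpace (EuclideanSpace ℝ (Fin d)) M] [IsManifold (𝓡 d) ∞ M]
    [RiemannianBundle (fun x : M => TangentSpace (𝓡 d) x)]
    [IsContMDiffRiemannianBundle (𝓡 d) ∞ (EuclideanSpace ℝ (Fin d))
      (fun x : M => TangentSpace (𝓡 d) x)]
    [IsRiemannianManifold (𝓡 d) M]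
    [MeasurableSpace M] [BorelSpace M]
    (f : M ≃ₘ^1⟮𝓡 d, 𝓡 d⟯ M)
    (F : M → EuclideanSpace ℝ (Fin n) → M)
    (hF : IsPhysicalRandomPerturbation (d := d) f F)
    (Λ : Set M) (hΛ : IsAttractor f Λ) :
    ∃ U : Set M, IsOpen U ∧ IsTrappingRegion f Λ U ∧
      ∃ ε₀ ∈ Ioo (0 : ℝ) 1, ∃ μ : ℝ → Measure M,
        (∀ ε ∈ Ioo 0 ε₀,
          (∀ t ∈ Metric.closedBall (0 : EuclideanSpace ℝ (Fin n)) ε,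
            (fun x => F x t) '' closure U ⊆ U) ∧
          IsPhysicalMeasure (normalizedVolume d M) F ε (μ ε) ∧
          Λ ⊆ (μ ε).support ∧ (μ ε).support ⊆ U ∧
          (∀ x ∈ U, GovernsRandomOrbit F ε (μ ε) x) ∧
          (∀ μ' : Measure M, IsProbabilityMeasure μ' → Λ ⊆ μ'.support → μ'.support ⊆ U →
            (∀ x ∈ U, GovernsRandomOrbit F ε μ' x) → μ' = μ ε) ∧
          (∀ μ' : Measure M, IsPhysicalMeasure (normalizedVolume d M) F ε μ' →
            μ'.support ⊆ U → μ' = μ ε)) ∧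
        Tendsto (fun ε => Metric.hausdorffEDist (μ ε).support Λ) (𝓝[>] 0) (𝓝 0) := by
  have hf : Continuous f := f.continuous
  have hFc := hF.contMDiffOn.continuousOn
  have : IsFiniteMeasure (normalizedVolume d M) := isFiniteMeasure_inv_smul_univ _
  obtain ⟨U, hU, -, hUt⟩ := hΛ.exists_isOpen_isTrappingRegion hf isOpen_univ (subset_univ _)
  have hΛU : Λ ⊆ U := subset_of_mem_nhdsSet hUt.nhds
  obtain ⟨z, hzΛ, -⟩ := hΛ.transitive
  have htrap : ∀ {U : Set M}, IsOpen U → IsTrappingRegion f Λ U →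
      ∃ ε₀ ∈ Ioo (0 : ℝ) 1, ∀ x ∈ closure U, ∀ t, ‖t‖ ≤ ε₀ → F x t ∈ U := fun hU hUt =>
    exists_noise_level_mapsTo hFc isClosed_closure.isCompact hU fun x hx => by
      rw [hF.map_zero]
      exact hUt.trapping (mem_image_of_mem _ hx)
  obtain ⟨ε₁, hε₁, hε₁U⟩ := htrap hU hUt
  obtain ⟨ε₂, hε₂, hspread⟩ := hF.spread
  refine ⟨U, hU, hUt, min ε₁ ε₂, ⟨lt_min hε₁.1 hε₂.1, (min_le_left _ _).trans_lt hε₁.2⟩, ?_⟩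
  have key : ∀ ε ∈ Ioo 0 (min ε₁ ε₂), ∃ μ : Measure M, IsProbabilityMeasure μ ∧ Λ ⊆ μ.support ∧
      normalizedVolume d M U ≠ 0 ∧
      ∀ x, ∀ᵐ t ∂(noiseProduct n ε), (∃ i, perturbedIterate F t i x ∈ closure U) →
        ∀ φ : C(M, ℝ), Tendsto
          (fun N : ℕ => (1 / (N : ℝ)) * ∑ j ∈ Finset.range N, φ (perturbedIterate F t j x))
          atTop (𝓝 (∫ y, φ y ∂μ)) := by
    intro ε hε
    obtain ⟨K, ξ, hξ, hfill, hac⟩ := hspread ε ⟨hε.1, hε.2.trans_le (min_le_right _ _)⟩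
    have hεε₁ : ε < ε₁ := hε.2.trans_le (min_le_left _ _)
    obtain ⟨hmU, μ, hμ, hΛμ, hgov⟩ := exists_measure_governing_random_orbits hf hFc hF.map_zero
      (normalizedVolume d M) hΛ hU hUt hε.1 (hεε₁.trans hε₁.2)
      (fun x hx t ht => hε₁U x hx t (ht.trans hεε₁.le)) hξ hfill hac
    exact ⟨μ, hμ, hΛμ, hmU, hgov⟩
  choose! μ hμ hΛμ hmU hgov using key
  have hUgov : ∀ ε ∈ Ioo 0 (min ε₁ ε₂), ∀ x ∈ U, GovernsRandomOrbit F ε (μ ε) x :=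
    fun ε hε x hx => by
      filter_upwards [hgov ε hε x] with t ht using ht ⟨0, subset_closure hx⟩
  have hprob : ∀ ε ∈ Ioo 0 (min ε₁ ε₂), (ae (noiseProduct n ε)).NeBot := fun ε hε => by
    have := isProbabilityMeasure_noiseMeasure (n := n) hε.1
    have : IsProbabilityMeasure (noiseProduct n ε) := by
      rw [noiseProduct]; infer_instance
    infer_instance
  refine ⟨μ, fun ε hε => ⟨?_, ⟨hμ ε hε, ?_⟩, hΛμ ε hε, ?_, hUgov ε hε, ?_, ?_⟩, ?_⟩
  · rintro t ht _ ⟨x, hx, rfl⟩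
    refine hε₁U x hx t ?_
    rw [mem_closedBall_zero_iff] at ht
    exact ht.trans (hε.2.le.trans (min_le_left _ _))
  · exact (pos_iff_ne_zero.2 (hmU ε hε)).trans_le (measure_mono (hUgov ε hε))
  · have := hμ ε hε
    have := hprob ε hε
    have hεε₁ : ε < ε₁ := hε.2.trans_le (min_le_left _ _)
    -- `closure U` contains the support but need not lie in `U`; its image under one noisy step is
    -- compact, lies in `U`, and contains the orbit from time `1` on.
    set D : Set M := (fun q : M × EuclideanSpace ℝ (Fin n) => F q.1 q.2) ''
      (closure U ×ˢ Metric.closedBall 0 ε) with hD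
    have hDc : IsCompact D :=
      (isClosed_closure.isCompact.prod (isCompact_closedBall _ _)).image_of_continuousOn
        (hFc.mono (prod_mono (subset_univ _)
          (Metric.closedBall_subset_ball (hεε₁.trans hε₁.2))))
    have hDU : D ⊆ U := by
      rintro _ ⟨⟨x, t⟩, ⟨hx, ht⟩, rfl⟩
      exact hε₁U x hx t ((mem_closedBall_zero_iff.1 ht).trans hεε₁.le)
    obtain ⟨t, ht, htΔ⟩ :=
      ((hUgov ε hε z (hΛU hzΛ)).and (ae_noiseProduct_mem_perturbationSpace hε.1)).exists
    refine (support_subset_of_tendsto_averages ht hDc.isClosed fun j hj => ?_).trans hDU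
    obtain ⟨i, rfl⟩ := Nat.exists_eq_add_of_le' hj
    refine ⟨(perturbedIterate F t i z, t i), ⟨?_, mem_closedBall_zero_iff.2 (htΔ i)⟩, rfl⟩
    exact perturbedIterate_mem_of_mapsTo (C := closure U)
      (fun x hx s hs => subset_closure (hε₁U x hx s (hs.trans hεε₁.le))) htΔ
      (subset_closure (hΛU hzΛ)) i
  · intro μ' hμ' _ _ hgov'
    have := hμ ε hε
    have := hprob ε hε
    obtain ⟨t, ht, ht'⟩ := ((hUgov ε hε z (hΛU hzΛ)).and (hgov' z (hΛU hzΛ))).exists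
    exact eq_of_tendsto_averages ht ht'
  · rintro μ' ⟨hμ', hpos⟩ hsupp
    have := hμ ε hε
    have := hprob ε hε
    -- This `x` may lie outside `U`, but its orbit must enter `U`, since `μ'` has its support there;
    -- from then on `μ ε` governs it as well.
    obtain ⟨x, hx⟩ := nonempty_of_measure_ne_zero hpos.ne'
    rw [mem_ofPred_eq] at hx
    obtain ⟨t, ht, ht'⟩ := ((hgov ε hε x).and hx).exists
    obtain ⟨j, hj⟩ := exists_mem_of_tendsto_averages ht' hU hsupp
    exact eq_of_tendsto_averages (ht ⟨j, subset_closure hj⟩) ht'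
  · rw [ENNReal.tendsto_nhds_zero]
    intro η hη
    -- A trapping region in the `η`-neighborhood of `Λ` also traps small noise, so an orbit started
    -- in `Λ` keeps the support within `η` of `Λ`; the other half of the Hausdorff bound is `Λ ⊆
    -- supp`.
    obtain ⟨V, hV, hVη, hVt⟩ := hΛ.exists_isOpen_isTrappingRegion hf
      (O := ⋃ w ∈ Λ, Metric.eball w η) (isOpen_biUnion fun y _ => Metric.isOpen_eball)
      (fun y hy => mem_biUnion hy (Metric.mem_eball_self hη))
    obtain ⟨ε₃, hε₃, hε₃V⟩ := htrap hV hVt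
    have hev : ∀ᶠ ε in 𝓝[>] (0 : ℝ), ε ∈ Ioo 0 (min (min ε₁ ε₂) ε₃) :=
      Ioo_mem_nhdsGT (lt_min (lt_min hε₁.1 hε₂.1) hε₃.1)
    filter_upwards [hev] with ε hε'
    have hε : ε ∈ Ioo 0 (min ε₁ ε₂) := ⟨hε'.1, hε'.2.trans_le (min_le_left _ _)⟩
    have hεε₃ : ε < ε₃ := hε'.2.trans_le (min_le_right _ _)
    have := hμ ε hε
    have := hprob ε hε
    have hzV : z ∈ closure V := subset_closure (subset_of_mem_nhdsSet hVt.nhds hzΛ)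
    obtain ⟨t, ht, htΔ⟩ :=
      ((hUgov ε hε z (hΛU hzΛ)).and (ae_noiseProduct_mem_perturbationSpace hε.1)).exists
    have hsub : (μ ε).support ⊆ closure V :=
      support_subset_of_tendsto_averages ht isClosed_closure fun j _ =>
        perturbedIterate_mem_of_mapsTo (C := closure V)
          (fun x hx s hs => subset_closure (hε₃V x hx s (hs.trans hεε₃.le))) htΔ hzV j
    refine Metric.hausdorffEDist_le_of_mem_edist (fun x hx => ?_) fun x hx =>
      ⟨x, hΛμ ε hε hx, by simp⟩
    obtain ⟨y, hy, hxy⟩ := mem_iUnion₂.1 (hVη (hsub hx))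
    exact ⟨y, hy, le_of_lt hxy⟩
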